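/- Let $d\ge 1$, $m\ge 2$, and let $|\cdot|$ be the Euclidean norm on $\mathbb{R}^d$ and the induced operator norm on matrices. **Setting.** Let $\Omega\subseteq\mathbb{R}^d$ be a non-empty bounded connected open set and $\Phi=\{\varphi_j\}_{1\le j\le m}$ a $C^{1+\alpha}$ conformal IFS on $\Omega$ for some $\alpha>0$. That is, each $\varphi_j:\Omega\to\mathbb{R}^d$ is injective, $C^1$ and contractive (Lipschitz with a constant $<1$) and satisfies $\varphi_j'(\mathbf{x})\ne 0$ and $|\varphi_j'(\mathbf{x})\mathbf{y}|=|\varphi_j'(\mathbf{x})|\,|\mathbf{y}|$ for all $\mathbf{x}\in\Omega$, $\mathbf{y}\in\mathbb{R}^d$; moreover $\overline{\varphi_j(\Omega)}\subseteq\Omega$, $0<\inf_\Omega|\varphi_j'|\le\sup_\Omega|\varphi_j'|<1$, and $\mathbf{x}\mapsto|\varphi_j'(\mathbf{x})|$ is $\alpha$-Hölder on $\Omega$. Assume the open set condition: there is a non-empty open $V\subseteq\Omega$ with $\varphi_j(V)\subseteq V$ for all $j$ and $\varphi_i(V)\cap\varphi_j(V)=\emptyset$ for $i\ne j$. Let $K\subseteq\Omega$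 be the non-empty compact set with $K=\bigcup_{j=1}^m\varphi_j(K)$. Let $\mu$ be a Gibbs measure on $K$: there are $\alpha'>0$ and positive $\alpha'$-Hölder functions $g_j:\varphi_j(\Omega)\to\mathbb{R}_{>0}$ such that, for the operator $\mathcal{L}f(\mathbf{x})=\sum_{j=1}^m g_j(\varphi_j(\mathbf{x}))f(\varphi_j(\mathbf{x}))$ on $C(K)$ with spectral radius $R=\lim_{n\to\infty}\|\mathcal{L}^n\|^{1/n}$, one has $\mathrm{d}\mu=h\,\mathrm{d}\nu$, where $h\in C(K)$ is positive, $\nu$ is a Borel probability measure on $K$, $\mathcal{L}h=Rh$, $\mathcal{L}^*\nu=R\nu$ and $\int_K h\,\mathrm{d}\nu=1$. Regard $\mu$ as a measure on $\mathbb{R}^d$. Fix $\mathbf{x}_0\in K$, let $\pi(i_1i_2\cdots)=\lim_{n\to\infty}\varphi_{i_1}\circ\cdots\circ\varphi_{i_n}(\mathbf{x}_0)$ be the coding map $\pi:\{1,\dots,m\}^{\mathbb{N}}\to K$, let $\sigma$ be the left shift on $\{1,\dots,m\}^{\mathbb{N}}$, and let $\widetilde K=\{\mathbf{x}\in K:\#\pi^{-1}(\mathbf{x})=1\}$.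 Define $T:\mathbb{R}^d\to\mathbb{R}^d$ by $T=\pi\circ\sigma\circ\pi^{-1}$ on $\widetilde K$ and $T(\mathbf{x})=\mathbf{x}$ for $\mathbf{x}\notin\widetilde K$. Then $(\Phi,K,\mu,T)$ is called a self-conformal system on $\mathbb{R}^d$. For $E\subseteq\mathbb{R}^d$ and $\varrho>0$ let $(E)_\varrho$ be the set of points at distance less than $\varrho$ from $E$ (empty if $E=\emptyset$), and let $\partial E$ be the topological boundary of $E$. **Theorem.** Let $(\Phi,K,\mu,T)$ be a self-conformal system on $\mathbb{R}^d$, and let $\mathcal{C}$ be a collection of $\mu$-measurable subsets of $\mathbb{R}^d$ for which there are constants $C>0$ and $\delta>0$ with $$\mu\big((\partial E)_\varrho\big)\le C\varrho^{\delta}\qquad\text{for all }\varrho>0\text{ and all }E\in\mathcal{C}.$$ Then $\mu$ is exponentially mixing with respect to $(T,\mathcal{C})$: $\mu$ is a $T$-invariant probability measure and there is $\gamma\in(0,1)$ such that, for integers $n\ge1$, $$\phi(n):=\sup\left\{\left|\frac{\mu(E\cap T^{-n}F)}{\mu(F)}-\mu(E)\right| : E\in\mathcal{C},\ F\subseteq\mathbb{R}^d\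 \mu\text{-measurable},\ \mu(F)>0\right\}=O(\gamma^n).$$ -/

import Mathlib

open Set Filter Topology MeasureTheory
open scoped NNReal ENNReal

/-- The Euclidean space `ℝ^d` (with the Euclidean norm). -/
abbrev Euc (d : ℕ) : Type := EuclideanSpace ℝ (Fin d)

section Mixing

variable {X : Type*} [MeasurableSpace X]

/-- The mixing coefficient
`φ(n) = sup { |μ(E ∩ T⁻ⁿF) / μ(F) - μ(E)| : E ∈ 𝒞, F μ-measurable, μ(F) > 0 }`,
as an extended non-negative real. "`μ`-measurable" means measurable for the completion
of `μ`. -/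
noncomputable def mixingCoeff (μ : Measure X) (T : X → X) (𝒞 : Set (Set X)) (n : ℕ) : ℝ≥0∞ :=
  ⨆ (E : Set X) (_ : E ∈ 𝒞) (F : Set X) (_ : NullMeasurableSet F μ) (_ : 0 < μ F),
    ENNReal.ofReal |μ.real (E ∩ T^[n] ⁻¹' F) / μ.real F - μ.real E|

/-- `(X, μ, T)` is a probability measure-preserving system and `φ(n) = O(γⁿ)` for some
`γ ∈ (0, 1)`. -/
structure IsExponentiallyMixing (μ : Measure X) (T : X → X) (𝒞 : Set (Set X)) : Prop where
  isProbabilityMeasure : IsProbabilityMeasure μ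
  measurePreserving : MeasurePreserving T μ μ
  exists_rate : ∃ γ : ℝ, 0 < γ ∧ γ < 1 ∧ ∃ C : ℝ, 0 < C ∧
    ∀ n : ℕ, 1 ≤ n → mixingCoeff μ T 𝒞 n ≤ ENNReal.ofReal (C * γ ^ n)

end Mixing

/-- `f` is a conformal map on the open set `Ω`: it is injective and `C¹` on `Ω`, and its
derivative at every point of `Ω` is non-zero and multiplies Euclidean lengths by its norm. -/
structure IsConformalMapOn {d : ℕ} (f : Euc d → Euc d) (Ω : Set (Euc d)) : Prop where
  contDiffOn : ContDiffOn ℝ 1 f Ω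
  injOn : InjOn f Ω
  fderiv_ne_zero : ∀ x ∈ Ω, fderiv ℝ f x ≠ 0
  norm_fderiv_apply : ∀ x ∈ Ω, ∀ y : Euc d, ‖fderiv ℝ f x y‖ = ‖fderiv ℝ f x‖ * ‖y‖

/-- A conformal iterated function system `{φ_j}` of `m ≥ 2` maps on a bounded connected
(non-empty) open set `Ω ⊆ ℝ^d`. Only the values of the maps on `Ω` matter. -/
structure ConformalIFS (d m : ℕ) where
  Ω : Set (Euc d)
  φ : Fin m → Euc d → Euc d
  two_le : 2 ≤ m
  isOpen : IsOpen Ω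
  isBounded : Bornology.IsBounded Ω
  isConnected : IsConnected Ω
  conformal : ∀ j, IsConformalMapOn (φ j) Ω
  contractive : ∀ j, ∃ c : ℝ≥0, c < 1 ∧ LipschitzOnWith c (φ j) Ω
  closure_image_subset : ∀ j, closure (φ j '' Ω) ⊆ Ω
  deriv_lower : ∀ j, ∃ a : ℝ, 0 < a ∧ ∀ x ∈ Ω, a ≤ ‖fderiv ℝ (φ j) x‖
  deriv_upper : ∀ j, ∃ b : ℝ, b < 1 ∧ ∀ x ∈ Ω, ‖fderiv ℝ (φ j) x‖ ≤ b

namespace ConformalIFS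

open TopologicalSpace (NonemptyCompacts)

variable {d m : ℕ} (Φ : ConformalIFS d m)

/-- `Φ` is of class `C^{1+α}`: `α > 0`, and `x ↦ |φ_j'(x)|` is `α`-Hölder on `Ω` for all `j`. -/
def IsC1Holder (α : ℝ≥0) : Prop :=
  0 < α ∧ ∀ j, ∃ C : ℝ≥0, HolderOnWith C α (fun x => ‖fderiv ℝ (Φ.φ j) x‖) Φ.Ω

/-- The open set condition. -/
def OpenSetCondition : Prop :=
  ∃ V : Set (Euc d), IsOpen V ∧ V.Nonempty ∧ V ⊆ Φ.Ω ∧ (∀ j, Φ.φ j '' V ⊆ V) ∧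
    ∀ i j, i ≠ j → Disjoint (Φ.φ i '' V) (Φ.φ j '' V)

/-- `K` is the self-conformal set generated by `Φ`, i.e. the (unique) non-empty compact
subset of `Ω` with `K = ⋃ j, φ_j(K)`. -/
def IsSelfConformalSet (K : NonemptyCompacts (Euc d)) : Prop :=
  (K : Set (Euc d)) ⊆ Φ.Ω ∧ (K : Set (Euc d)) = ⋃ j, Φ.φ j '' K

/-- Positive `α'`-Hölder potentials `g_j : φ_j(Ω) → ℝ_{>0}`. Only the values of `g_j` on
`φ_j(Ω)` matter. -/
structure HolderPotential where
  g : Fin m → Euc d → ℝ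
  exponent : ℝ≥0
  exponent_pos : 0 < exponent
  pos : ∀ j, ∀ x ∈ Φ.φ j '' Φ.Ω, 0 < g j x
  holder : ∀ j, ∃ C : ℝ≥0, HolderOnWith C exponent (g j) (Φ.φ j '' Φ.Ω)

variable {Φ}

/-- The restriction of `φ_j` to a map `K → K`. -/
def selfMap {K : NonemptyCompacts (Euc d)} (hK : Φ.IsSelfConformalSet K) (j : Fin m) :
    C(K, K) where
  toFun x := ⟨Φ.φ j x, by
    have h : Φ.φ j x ∈ ⋃ i, Φ.φ i '' (K : Set (Euc d)) :=
      mem_iUnion.2 ⟨j, mem_image_of_mem _ x.2⟩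
    rw [← hK.2] at h
    exact h⟩
  continuous_toFun := by
    refine Continuous.subtype_mk ?_ _
    exact ((Φ.conformal j).contDiffOn.continuousOn.mono hK.1).domRestrict

/-- The weight `x ↦ g_j(φ_j(x))` as a continuous function on `K`. -/
def HolderPotential.weight (G : Φ.HolderPotential) {K : NonemptyCompacts (Euc d)}
    (hK : Φ.IsSelfConformalSet K) (j : Fin m) : C(K, ℝ) where
  toFun x := G.g j (Φ.φ j x)
  continuous_toFun := by
    obtain ⟨C, hC⟩ := G.holder j
    have h : ContinuousOn (fun x => G.g j (Φ.φ j x)) Φ.Ω :=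
      (hC.continuousOn G.exponent_pos).comp (Φ.conformal j).contDiffOn.continuousOn
        (mapsTo_image _ _)
    exact (h.mono hK.1).domRestrict

/-- The Ruelle operator `(𝓛 f)(x) = ∑ j, g_j(φ_j(x)) f(φ_j(x))`, as a bounded linear operator on
the Banach space `C(K)` with the supremum norm. -/
noncomputable def HolderPotential.ruelle (G : Φ.HolderPotential) {K : NonemptyCompacts (Euc d)}
    (hK : Φ.IsSelfConformalSet K) : C(K, ℝ) →L[ℝ] C(K, ℝ) where
  toFun f := ∑ j, G.weight hK j * f.comp (selfMap hK j)
  map_add' f₁ f₂ := by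
    rw [← Finset.sum_add_distrib]
    exact Finset.sum_congr rfl fun j _ => by ext x; simp [mul_add]
  map_smul' c f := by
    rw [RingHom.id_apply, Finset.smul_sum]
    exact Finset.sum_congr rfl fun j _ => by ext x; simp
  cont := by
    refine continuous_finsetSum _ fun j _ => ?_
    exact continuous_const.mul (ContinuousMap.continuous_precomp _)

/-- `μ` is a Gibbs measure on `K` (regarded as a measure on `ℝ^d`) for the potentials `G`:
`dμ = h dν`, where, `R` being the spectral radius `lim ‖𝓛ⁿ‖^{1/n}` of the Ruelle operator `𝓛`,
`h ∈ C(K)` is positive with `𝓛 h = R h`, `ν` is a Borel probability measure on `K` with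
`𝓛* ν = R ν`, that is `∫ 𝓛 f dν = R ∫ f dν` for all `f ∈ C(K)`, and `∫ h dν = 1`. -/
def HolderPotential.IsGibbsMeasure (G : Φ.HolderPotential) {K : NonemptyCompacts (Euc d)}
    (hK : Φ.IsSelfConformalSet K) (μ : Measure (Euc d)) : Prop :=
  ∃ (R : ℝ) (h : C(K, ℝ)) (ν : Measure K),
    Tendsto (fun n : ℕ => ‖(G.ruelle hK) ^ n‖ ^ (1 / (n : ℝ))) atTop (𝓝 R) ∧
    (∀ x, 0 < h x) ∧
    G.ruelle hK h = R • h ∧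
    IsProbabilityMeasure ν ∧
    (∀ f : C(K, ℝ), ∫ x, G.ruelle hK f x ∂ν = R * ∫ x, f x ∂ν) ∧
    ∫ x, h x ∂ν = 1 ∧
    μ = (ν.withDensity fun x => ENNReal.ofReal (h x)).map (Subtype.val : K → Euc d)

variable (Φ)

/-- `φ_{i_1} ∘ ⋯ ∘ φ_{i_n}` for the infinite word `I = i_1 i_2 ⋯` (indexed from `0` here). -/
def prefixMap (I : ℕ → Fin m) : ℕ → Euc d → Euc d
  | 0 => id
  | n + 1 => prefixMap I n ∘ Φ.φ (I n)

/-- The coding map `π(I) = lim φ_{i_1} ∘ ⋯ ∘ φ_{i_n}(x₀)`; the limit exists and does not depend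
on `x₀` for `x₀ ∈ K`. -/
noncomputable def codingMap (x₀ : Euc d) (I : ℕ → Fin m) : Euc d :=
  limUnder atTop fun n => Φ.prefixMap I n x₀

/-- The set `K̃` of the points of `K` with exactly one symbolic representation. -/
def uniquelyCoded (K : NonemptyCompacts (Euc d)) (x₀ : Euc d) : Set (Euc d) :=
  {x | x ∈ K ∧ ∃! I : ℕ → Fin m, Φ.codingMap x₀ I = x}

open Classical in
/-- The map `T : ℝ^d → ℝ^d` equal to `π ∘ σ ∘ π⁻¹` on `K̃`, where `σ` is the left shift, and to
the identity off `K̃`. -/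
noncomputable def inducedMap (K : NonemptyCompacts (Euc d)) (x₀ x : Euc d) : Euc d :=
  if hx : x ∈ Φ.uniquelyCoded K x₀ then Φ.codingMap x₀ fun n => hx.2.choose (n + 1) else x

/-- `(Φ, K, μ, T)` is a self-conformal system on `ℝ^d`. -/
structure IsSelfConformalSystem (K : NonemptyCompacts (Euc d)) (μ : Measure (Euc d))
    (T : Euc d → Euc d) : Prop where
  isC1Holder : ∃ α : ℝ≥0, Φ.IsC1Holder α
  openSetCondition : Φ.OpenSetCondition
  isSelfConformalSet : Φ.IsSelfConformalSet K
  isGibbsMeasure : ∃ G : Φ.HolderPotential, G.IsGibbsMeasure isSelfConformalSet μ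
  map_eq : ∃ x₀ ∈ K, T = Φ.inducedMap K x₀

end ConformalIFS

/-! Dividing by the eigenfunction makes the Gibbs measure a fixed point of the dual of `P u = ∑ j,
p_j · (u ∘ φ_j)`, where `p_j = (g_j ∘ φ_j)(h ∘ φ_j) / (R h)` is positive, log-Hölder and sums to 1
over `j` (`HolderPotential.IsGibbsMeasure.exists_transferInvariant`). Once `T` is known to invert
every `φ_j` almost everywhere, `∫ u · (G ∘ Tⁿ) dμ = ∫ Pⁿu · G dμ`. A uniform estimate of `Pⁿu` with
`G = 1_F` then yields an error proportional to `μ(F)`, whatever the set `F`.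

Two uniform estimates are needed, both coming from bounded distortion of the weights of `Pⁿ`. For
Hölder `u`, the oscillation of `Pⁿu` decays exponentially, at a cost linear in the Hölder constant
(`exists_transfer_iterate_osc_decay`). For a set `S`, `Pⁿ 1_S` is at every point at most a constant
times the measure of a neighbourhood of `S` of radius comparable to `cⁿ`
(`transfer_iterate_indicator_le`). The indicator of `E` is replaced by a thickened indicator at
scale `ρ = σⁿ`: its Hölder constant `1/ρ` is beaten by the decay, and the error lives near `∂E`,
where the boundary hypothesis gives a power of `ρ`.

That `T` inverts the branches almost everywhere is where the open set condition enters. A volume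
count bounds the number of words whose cylinders meet that of a given word at a comparable scale. A
word `u` with the maximal number of such neighbours is rigid: its occurrence in a coding determines
all earlier letters (`exists_separating_word`). Each application of `P^|u|` sends a definite
proportion of mass through `u`, so almost every point has codings containing `u` arbitrarily far
out, hence has only one coding. -/

section Transfer

/-! ### Normalized transfer operators and decay of oscillation. -/

variable {ι X : Type*} [Fintype ι]

/-- The transfer operator with weights `p` along the maps `f`. -/
def transfer (p : ι → X → ℝ) (f : ι → X → X) (G : X → ℝ) (x : X) : ℝ :=
  ∑ j, p j x * G (f j x)

theorem transfer_mono {p : ι → X → ℝ} {f : ι → X → X} (hp : ∀ j x, 0 ≤ p j x) :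
    Monotone (transfer p f) := fun _ _ h x =>
  Finset.sum_le_sum fun j _ => mul_le_mul_of_nonneg_left (h (f j x)) (hp j x)

theorem transfer_iterate_nonneg {p : ι → X → ℝ} {f : ι → X → X} (hp : ∀ j x, 0 ≤ p j x)
    (n : ℕ) {G : X → ℝ} (hG : ∀ x, 0 ≤ G x) : ∀ x, 0 ≤ (transfer p f)^[n] G x := by
  induction n with
  | zero => exact hG
  | succ n ih =>
    intro x
    rw [Function.iterate_succ_apply']
    exact Finset.sum_nonneg fun j _ => mul_nonneg (hp j x) (ih _)

theorem transfer_iterate_affine {p : ι → X → ℝ} {f : ι → X → X} (hsum : ∀ x, ∑ j, p j x = 1)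
    (n : ℕ) (G : X → ℝ) (s a : ℝ) (x : X) :
    (transfer p f)^[n] (fun y => s * G y + a) x = s * (transfer p f)^[n] G x + a := by
  induction n generalizing x with
  | zero => rfl
  | succ n ih =>
    simp only [Function.iterate_succ_apply', transfer]
    simp only [ih, mul_add, Finset.sum_add_distrib, ← Finset.sum_mul, hsum, one_mul,
      Finset.mul_sum]
    congr 1
    exact Finset.sum_congr rfl fun j _ => by ring

theorem transfer_iterate_const {p : ι → X → ℝ} {f : ι → X → X} (hsum : ∀ x, ∑ j, p j x = 1)
    (n : ℕ) (a : ℝ) (x : X) : (transfer p f)^[n] (fun _ => a) x = a := by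
  simpa using transfer_iterate_affine hsum n (fun _ => 0) 0 a x

theorem transfer_iterate_le_one {p : ι → X → ℝ} {f : ι → X → X} (hp : ∀ j x, 0 ≤ p j x)
    (hsum : ∀ x, ∑ j, p j x = 1) (n : ℕ) {G : X → ℝ} (hG : ∀ x, G x ≤ 1) (x : X) :
    (transfer p f)^[n] G x ≤ 1 := by
  have h := (transfer_mono (f := f) hp).iterate n (show G ≤ fun _ => (1 : ℝ) from hG) x
  rwa [transfer_iterate_const hsum] at h

theorem transfer_iterate_osc_le {p : ι → X → ℝ} {f : ι → X → X} (hp : ∀ j x, 0 ≤ p j x)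
    (hsum : ∀ x, ∑ j, p j x = 1) (n : ℕ) {G : X → ℝ} {s : ℝ} (hG : ∀ x y, G x - G y ≤ s)
    (x y : X) : (transfer p f)^[n] G x - (transfer p f)^[n] G y ≤ s := by
  have h1 : ∀ z, (transfer p f)^[n] G x ≤ s + G z := fun z => by
    have h := (transfer_mono (f := f) hp).iterate n
      (show G ≤ fun _ => s + G z from fun w => by linarith [hG w z]) x
    rwa [transfer_iterate_const hsum] at h
  have h := (transfer_mono (f := f) hp).iterate n
      (show (fun _ => (transfer p f)^[n] G x - s) ≤ G from fun w => by linarith [h1 w]) y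
  rw [transfer_iterate_const hsum] at h
  linarith

variable [MetricSpace X]

/-- The constant `C / (1 - c ^ β)` is the sum of the geometric series of distortions accumulated
along a contracting orbit; adding one more term in front reproduces it. -/
theorem distortion_combine {c β C d d' : ℝ} (hc : 0 < c) (hc1 : c < 1) (hβ : 0 < β)
    (hC : 0 ≤ C) (hd' : 0 ≤ d') (hd : 0 ≤ d) (h : d' ≤ c * d) :
    C * d ^ β + C / (1 - c ^ β) * d' ^ β ≤ C / (1 - c ^ β) * d ^ β := by
  have h1 : 0 < 1 - c ^ β := sub_pos.2 (Real.rpow_lt_one hc.le hc1 hβ)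
  have h2 : d' ^ β ≤ c ^ β * d ^ β := by
    rw [← Real.mul_rpow hc.le hd]
    exact Real.rpow_le_rpow hd' h hβ.le
  have h3 : C / (1 - c ^ β) * d' ^ β ≤ C / (1 - c ^ β) * (c ^ β * d ^ β) := by gcongr
  have h4 : C / (1 - c ^ β) * (1 - c ^ β) = C := by field_simp
  calc _ ≤ C * d ^ β + C / (1 - c ^ β) * (c ^ β * d ^ β) := by linarith
    _ = (C / (1 - c ^ β) * (1 - c ^ β)) * d ^ β + C / (1 - c ^ β) * (c ^ β * d ^ β) := by rw [h4]
    _ = _ := by ring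

/-- Bounded distortion for the iterates of a transfer operator along contractions. -/
theorem transfer_iterate_comparison {a : ι → X → ℝ} {f : ι → X → X} {c β C : ℝ}
    (hc : 0 < c) (hc1 : c < 1) (hβ : 0 < β) (hC : 0 ≤ C) (ha0 : ∀ j x, 0 ≤ a j x)
    (ha : ∀ j x y, a j x ≤ Real.exp (C * dist x y ^ β) * a j y)
    (hf : ∀ j x y, dist (f j x) (f j y) ≤ c * dist x y) {G G' : X → ℝ}
    (hG' : ∀ x, 0 ≤ G' x) (n : ℕ) (x y : X)
    (h : ∀ x' y', dist x' y' ≤ c ^ n * dist x y → G x' ≤ G' y') :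
    (transfer a f)^[n] G x ≤
      Real.exp (C / (1 - c ^ β) * dist x y ^ β) * (transfer a f)^[n] G' y := by
  have h1 : 0 < 1 - c ^ β := sub_pos.2 (Real.rpow_lt_one hc.le hc1 hβ)
  induction n generalizing x y with
  | zero =>
    simp only [Function.iterate_zero, id]
    calc G x ≤ 1 * G' y := by rw [one_mul]; exact h x y (by simp)
      _ ≤ _ := by
        gcongr
        · exact hG' y
        · exact Real.one_le_exp (by positivity)
  | succ n ih =>
    simp only [Function.iterate_succ_apply', transfer]
    rw [Finset.mul_sum]
    refine Finset.sum_le_sum fun j _ => ?_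
    have hn := transfer_iterate_nonneg (f := f) ha0 n hG' (f j y)
    calc a j x * (transfer a f)^[n] G (f j x)
        ≤ (a j x) * (Real.exp (C / (1 - c ^ β) * dist (f j x) (f j y) ^ β) *
          (transfer a f)^[n] G' (f j y)) := by
          -- One contraction by `f j` is traded for one power of `c`, so the closeness hypothesis
          -- for `n + 1` at `x, y` becomes that for `n` at the images.
          refine mul_le_mul_of_nonneg_left (ih _ _ fun x' y' hxy => h _ _ (hxy.trans ?_)) (ha0 j x)
          rw [pow_succ, mul_assoc]
          exact mul_le_mul_of_nonneg_left (hf j x y) (by positivity)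
      _ ≤ (Real.exp (C * dist x y ^ β) * a j y) *
          (Real.exp (C / (1 - c ^ β) * dist (f j x) (f j y) ^ β) *
          (transfer a f)^[n] G' (f j y)) :=
          mul_le_mul_of_nonneg_right (ha j x y) (by positivity)
      _ = Real.exp (C * dist x y ^ β + C / (1 - c ^ β) * dist (f j x) (f j y) ^ β) *
          (a j y * (transfer a f)^[n] G' (f j y)) := by rw [Real.exp_add]; ring
      _ ≤ _ := by
          refine mul_le_mul_of_nonneg_right (Real.exp_le_exp.2 ?_) (mul_nonneg (ha0 j y) hn)
          exact distortion_combine hc hc1 hβ hC dist_nonneg dist_nonneg (hf j x y)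

theorem exp_sub_one_le_mul_exp (t : ℝ) : Real.exp t - 1 ≤ t * Real.exp t := by
  have h := Real.add_one_le_exp (-t)
  have h2 := mul_le_mul_of_nonneg_right h (Real.exp_pos t).le
  rw [← Real.exp_add] at h2
  simp at h2
  linarith

/-- The first bound contracts the oscillation and the second is a Lasota–Yorke inequality.
Distortion bounds the ratio of the values of `Pⁿ` at two points for nonnegative functions; it is
applied to `G - inf G` and to `inf G + s - G`, with an additive error `ε` for the variation of `G`
at scale `c ^ n`. -/
theorem transfer_iterate_holder_step {p : ι → X → ℝ} {f : ι → X → X} {c β C D : ℝ}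
    (hc : 0 < c) (hc1 : c < 1) (hβ : 0 < β) (hC : 0 ≤ C) (hp : ∀ j x, 0 ≤ p j x)
    (hsum : ∀ x, ∑ j, p j x = 1)
    (ha : ∀ j x y, p j x ≤ Real.exp (C * dist x y ^ β) * p j y)
    (hf : ∀ j x y, dist (f j x) (f j y) ≤ c * dist x y) (hD : ∀ x y : X, dist x y ≤ D)
    {G : X → ℝ} {s H : ℝ} (hH : 0 ≤ H)
    (hs : ∀ x y, G x - G y ≤ s) (hG : ∀ x y, G x - G y ≤ H * dist x y ^ β) (n : ℕ) (x y : X) :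
    let C' := C / (1 - c ^ β)
    let A := Real.exp (C' * D ^ β)
    (transfer p f)^[n] G x - (transfer p f)^[n] G y ≤
      (A - 1) / (A + 1) * s + 2 * ((c ^ β) ^ n * D ^ β) * H ∧
    (transfer p f)^[n] G x - (transfer p f)^[n] G y ≤
      (C' * A * s + A * (c ^ β) ^ n * H) * dist x y ^ β := by
  intro C' A
  have h1 : 0 < 1 - c ^ β := sub_pos.2 (Real.rpow_lt_one hc.le hc1 hβ)
  have hC' : 0 ≤ C' := by positivity
  have hcn : (c ^ n) ^ β = (c ^ β) ^ n := by
    rw [← Real.rpow_natCast, ← Real.rpow_natCast, ← Real.rpow_mul hc.le, ← Real.rpow_mul hc.le,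
      mul_comm]
  have hbdd : BddBelow (range G) := ⟨G x - s, by rintro _ ⟨z, rfl⟩; linarith [hs x z]⟩
  set m := sInf (range G) with hm
  have hm0 : ∀ z, m ≤ G z := fun z => csInf_le hbdd ⟨z, rfl⟩
  have hms : ∀ z, G z - s ≤ m := fun z =>
    le_csInf ⟨_, z, rfl⟩ (by rintro _ ⟨w, rfl⟩; linarith [hs z w])
  have hs0 : 0 ≤ s := by simpa using hs x x
  have hd0 : 0 ≤ dist x y := dist_nonneg
  have hdD := hD x y
  have hdβ : dist x y ^ β ≤ D ^ β := Real.rpow_le_rpow hd0 hdD hβ.le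
  have hd0β : 0 ≤ dist x y ^ β := by positivity
  set E := Real.exp (C' * dist x y ^ β) with hE
  have hEA : E ≤ A := Real.exp_le_exp.2 (mul_le_mul_of_nonneg_left hdβ hC')
  have hE1 : 1 ≤ E := Real.one_le_exp (by positivity)
  have hA1 : 1 ≤ A := hE1.trans hEA
  set ε := H * ((c ^ β) ^ n * dist x y ^ β) with hε
  have hcβ : 0 ≤ (c ^ β) ^ n := by positivity
  have hε0 : 0 ≤ ε := by positivity
  have hclose : ∀ x' y', dist x' y' ≤ c ^ n * dist x y → G x' - G y' ≤ ε := fun x' y' h => by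
    refine (hG x' y').trans (mul_le_mul_of_nonneg_left ?_ hH)
    rw [← hcn, ← Real.mul_rpow (by positivity) hd0]
    exact Real.rpow_le_rpow dist_nonneg h hβ.le
  set u := (transfer p f)^[n] G x with hu
  set v := (transfer p f)^[n] G y with hv
  have hvs : v - m ≤ s := by
    have h := (transfer_mono (f := f) hp).iterate n
      (show G ≤ fun _ => m + s from fun w => by linarith [hms w]) y
    rw [transfer_iterate_const hsum] at h
    linarith
  have hum : m ≤ u := by
    have h := (transfer_mono (f := f) hp).iterate n (show (fun _ => m) ≤ G from hm0) x
    rwa [transfer_iterate_const hsum] at h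
  have hus : u - m ≤ s := by
    have h := (transfer_mono (f := f) hp).iterate n
      (show G ≤ fun _ => m + s from fun w => by linarith [hms w]) x
    rw [transfer_iterate_const hsum] at h
    linarith
  have hvm : m ≤ v := by
    have h := (transfer_mono (f := f) hp).iterate n (show (fun _ => m) ≤ G from hm0) y
    rwa [transfer_iterate_const hsum] at h
  have k1 : u - m ≤ E * (v - m + ε) := by
    have h := transfer_iterate_comparison (f := f) (G := fun z => 1 * G z + -m)
      (G' := fun z => 1 * G z + (-m + ε)) hc hc1 hβ hC hp ha hf
      (fun z => by linarith [hm0 z]) n x y (fun x' y' h => by linarith [hclose x' y' h])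
    rw [transfer_iterate_affine hsum, transfer_iterate_affine hsum] at h
    calc u - m = 1 * u + -m := by ring
      _ ≤ E * (1 * v + (-m + ε)) := h
      _ = _ := by ring
  have k2 : m + s - v ≤ E * (m + s - u + ε) := by
    have h := transfer_iterate_comparison (f := f) (G := fun z => -1 * G z + (m + s))
      (G' := fun z => -1 * G z + (m + s + ε)) hc hc1 hβ hC hp ha hf
      (fun z => by linarith [hms z]) n y x (fun x' y' h => by
        rw [dist_comm y x, dist_comm x' y'] at h
        linarith [hclose y' x' h])
    rw [transfer_iterate_affine hsum, transfer_iterate_affine hsum, dist_comm y x] at h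
    calc m + s - v = -1 * v + (m + s) := by ring
      _ ≤ E * (-1 * u + (m + s + ε)) := h
      _ = _ := by ring
  constructor
  · have k1' : u - m ≤ A * (v - m + ε) :=
      k1.trans (mul_le_mul_of_nonneg_right hEA (by linarith))
    have k2' : m + s - v ≤ A * (m + s - u + ε) :=
      k2.trans (mul_le_mul_of_nonneg_right hEA (by linarith))
    have hεD : ε ≤ (c ^ β) ^ n * D ^ β * H := by
      rw [hε, mul_comm]; gcongr
    -- Sum of `k1'` and `k2'`: the unknown offset `m` cancels and only `u - v` and `s` remain.
    have k3 : (u - v) * (A + 1) ≤ (A - 1) * s + 2 * A * ε := by nlinarith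
    have k4 : 2 * A * ε ≤ 2 * ε * (A + 1) := by nlinarith
    have k5 : u - v ≤ (A - 1) / (A + 1) * s + 2 * ε := by
      rw [div_mul_eq_mul_div, div_add' _ _ _ (by positivity), le_div_iff₀ (by positivity)]
      linarith
    linarith
  · have hE2 : E - 1 ≤ C' * A * dist x y ^ β := by
      have h := exp_sub_one_le_mul_exp (C' * dist x y ^ β)
      have : C' * dist x y ^ β * E ≤ C' * dist x y ^ β * A :=
        mul_le_mul_of_nonneg_left hEA (by positivity)
      rw [← hE] at h
      linarith
    have k3 : (E - 1) * (v - m) ≤ C' * A * dist x y ^ β * s :=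
      mul_le_mul hE2 hvs (by linarith) (by positivity)
    have k4 : E * ε ≤ A * ε := mul_le_mul_of_nonneg_right hEA hε0
    have k5 : A * ε = A * (c ^ β) ^ n * H * dist x y ^ β := by rw [hε]; ring
    linarith

/-- Exponential decay of the oscillation of `Pⁿ G` for Hölder functions `G`. -/
theorem exists_transfer_iterate_osc_decay {p : ι → X → ℝ} {f : ι → X → X} {c β C D : ℝ}
    (hc : 0 < c) (hc1 : c < 1) (hβ : 0 < β) (hC : 0 ≤ C) (hp : ∀ j x, 0 ≤ p j x)
    (hsum : ∀ x, ∑ j, p j x = 1)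
    (ha : ∀ j x y, p j x ≤ Real.exp (C * dist x y ^ β) * p j y)
    (hf : ∀ j x y, dist (f j x) (f j y) ≤ c * dist x y) (hD : ∀ x y : X, dist x y ≤ D)
    (hD0 : 0 ≤ D) :
    ∃ B γ : ℝ, 0 < B ∧ 0 < γ ∧ γ < 1 ∧ ∀ (G : X → ℝ) (H : ℝ), 1 ≤ H →
      (∀ x y, G x - G y ≤ 1) → (∀ x y, G x - G y ≤ H * dist x y ^ β) →
      ∀ n x y, (transfer p f)^[n] G x - (transfer p f)^[n] G y ≤ B * H * γ ^ n := by
  have h1 : 0 < 1 - c ^ β := sub_pos.2 (Real.rpow_lt_one hc.le hc1 hβ)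
  set C' := C / (1 - c ^ β) with hC'
  have hC'0 : 0 ≤ C' := by positivity
  set A := Real.exp (C' * D ^ β) with hA
  have hA1 : 1 ≤ A := Real.one_le_exp (by positivity)
  set θ := (A - 1) / (A + 1) with hθ
  have hθ0 : 0 ≤ θ := div_nonneg (by linarith) (by linarith)
  have hθ1 : θ < 1 := by rw [hθ, div_lt_one (by linarith)]; linarith
  -- The functional `s + b * H` is contracted by `τ` after `N` steps. Any `τ` strictly between `θ`
  -- and 1 will do: `b` is small enough for the feedback of `s` into the Hölder constant to fit into
  -- `τ - θ`, then `N` is large enough for the terms in `H` to fit into `τ * b`.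
  set τ := (1 + θ) / 2 with hτ
  have hτ0 : 0 < τ := by linarith
  have hτ1 : τ < 1 := by linarith
  set b := (τ - θ) / (C' * A + 1) with hb
  have hb0 : 0 < b := div_pos (by linarith) (by positivity)
  have hb1 : θ + b * (C' * A) ≤ τ := by
    have : b * (C' * A + 1) = τ - θ := by rw [hb]; field_simp
    linarith
  obtain ⟨N, hN0, hN⟩ : ∃ N : ℕ, 0 < N ∧
      2 * ((c ^ β) ^ N * D ^ β) + b * (A * (c ^ β) ^ N) ≤ τ * b := by
    have hlim : Tendsto (fun N : ℕ => 2 * ((c ^ β) ^ N * D ^ β) + b * (A * (c ^ β) ^ N)) atTop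
        (𝓝 (2 * (0 * D ^ β) + b * (A * 0))) := by
      have := tendsto_pow_atTop_nhds_zero_of_lt_one (r := c ^ β) (by positivity) (by linarith)
      exact ((this.mul_const _).const_mul _).add ((this.const_mul _).const_mul _)
    have hlt : 2 * (0 * D ^ β) + b * (A * 0) < τ * b := by
      rw [zero_mul, mul_zero, mul_zero, mul_zero, add_zero]
      positivity
    obtain ⟨N, h, h'⟩ := ((hlim.eventually_lt_const hlt).and (eventually_gt_atTop 0)).exists
    exact ⟨N, h', h.le⟩
  have key : ∀ (G : X → ℝ) (s H : ℝ), 0 ≤ s → 0 ≤ H → (∀ x y, G x - G y ≤ s) →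
      (∀ x y, G x - G y ≤ H * dist x y ^ β) → ∀ k : ℕ, ∃ s' H', 0 ≤ s' ∧ 0 ≤ H' ∧
      (∀ x y, (transfer p f)^[N * k] G x - (transfer p f)^[N * k] G y ≤ s') ∧
      (∀ x y, (transfer p f)^[N * k] G x - (transfer p f)^[N * k] G y ≤ H' * dist x y ^ β) ∧
      s' + b * H' ≤ τ ^ k * (s + b * H) := by
    intro G s H hs0 hH0 hs hH k
    induction k with
    | zero => exact ⟨s, H, hs0, hH0, hs, hH, by simp⟩
    | succ k ih =>
      obtain ⟨s', H', hs0', hH0', h1, h2, h3⟩ := ih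
      refine ⟨θ * s' + 2 * ((c ^ β) ^ N * D ^ β) * H', C' * A * s' + A * (c ^ β) ^ N * H',
        by positivity, by positivity, fun x y => ?_, fun x y => ?_, ?_⟩
      · rw [mul_add, mul_one, add_comm, Function.iterate_add_apply]
        exact (transfer_iterate_holder_step hc hc1 hβ hC hp hsum ha hf hD hH0' h1 h2 N x y).1
      · rw [mul_add, mul_one, add_comm, Function.iterate_add_apply]
        exact (transfer_iterate_holder_step hc hc1 hβ hC hp hsum ha hf hD hH0' h1 h2 N x y).2
      · calc _ = (θ + b * (C' * A)) * s' +
            (2 * ((c ^ β) ^ N * D ^ β) + b * (A * (c ^ β) ^ N)) * H' := by ring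
          _ ≤ τ * s' + τ * b * H' := by gcongr
          _ = τ * (s' + b * H') := by ring
          _ ≤ τ * (τ ^ k * (s + b * H)) := by gcongr
          _ = _ := by ring
  set γ := τ ^ (1 / (N : ℝ)) with hγ
  have hγ0 : 0 < γ := by positivity
  have hN0' : (0 : ℝ) < N := by exact_mod_cast hN0
  have hγ1 : γ < 1 := Real.rpow_lt_one hτ0.le hτ1 (by positivity)
  have hγN : γ ^ N = τ := by
    rw [hγ, ← Real.rpow_natCast, ← Real.rpow_mul hτ0.le, one_div_mul_cancel hN0'.ne',
      Real.rpow_one]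
  -- Division by `τ` pays for the remainder of `n` modulo `N`, during which the oscillation merely
  -- does not increase.
  refine ⟨(1 + b) / τ, γ, by positivity, hγ0, hγ1, fun G H hH1 hG1 hGH n x y => ?_⟩
  obtain ⟨s', H', hs0', hH0', k1, -, k3⟩ := key G 1 H zero_le_one (by linarith) hG1 hGH (n / N)
  have e1 : n = n % N + N * (n / N) := (Nat.mod_add_div n N).symm
  have e2 : (transfer p f)^[n] G x - (transfer p f)^[n] G y ≤ s' := by
    rw [e1, Function.iterate_add_apply]
    exact transfer_iterate_osc_le hp hsum _ k1 x y
  have e3 : τ ^ (n / N) * τ ≤ γ ^ n := by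
    conv_rhs => rw [e1, pow_add, pow_mul, hγN, mul_comm]
    gcongr
    conv_lhs => rw [← hγN]
    exact pow_le_pow_of_le_one hγ0.le hγ1.le (Nat.mod_lt n hN0).le
  calc _ ≤ s' := e2
    _ ≤ τ ^ (n / N) * (1 + b * H) := by nlinarith
    _ ≤ τ ^ (n / N) * ((1 + b) * H) := by gcongr; nlinarith
    _ = (1 + b) / τ * H * (τ ^ (n / N) * τ) := by field_simp
    _ ≤ (1 + b) / τ * H * γ ^ n := by gcongr

end Transfer

/-! ### Compositions along finite words. -/

section WordMap

variable {ι X : Type*}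

/-- The composition `f_{i_1} ∘ ⋯ ∘ f_{i_n}` along a finite word. -/
def wordMap (f : ι → X → X) : List ι → X → X
  | [] => id
  | j :: w => f j ∘ wordMap f w

theorem wordMap_append (f : ι → X → X) (w v : List ι) (x : X) :
    wordMap f (w ++ v) x = wordMap f w (wordMap f v x) := by
  induction w with
  | nil => rfl
  | cons j w ih => exact congrArg (f j) ih

theorem wordMap_continuous [TopologicalSpace X] {f : ι → X → X} (hf : ∀ j, Continuous (f j))
    (w : List ι) : Continuous (wordMap f w) := by
  induction w with
  | nil => exact continuous_id
  | cons j w ih => exact (hf j).comp ih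

theorem wordMap_mapsTo {f : ι → X → X} {S : Set X} (hf : ∀ j, MapsTo (f j) S S) (w : List ι) :
    MapsTo (wordMap f w) S S := by
  induction w with
  | nil => exact mapsTo_id S
  | cons j w ih => exact (hf j).comp ih

theorem wordMap_injOn {f : ι → X → X} {S : Set X} (hf : ∀ j, MapsTo (f j) S S)
    (hi : ∀ j, InjOn (f j) S) (w : List ι) : InjOn (wordMap f w) S := by
  induction w with
  | nil => exact injOn_id S
  | cons j w ih => exact (hi j).comp ih (wordMap_mapsTo hf w)

theorem exists_wordMap_eq {f : ι → X → X} {S : Set X} (hS : S ⊆ ⋃ j, f j '' S) (n : ℕ) {x : X}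
    (hx : x ∈ S) : ∃ w : List ι, w.length = n ∧ ∃ y ∈ S, wordMap f w y = x := by
  induction n generalizing x with
  | zero => exact ⟨[], rfl, x, hx, rfl⟩
  | succ n ih =>
    obtain ⟨j, y, hy, rfl⟩ := mem_iUnion.1 (hS hx)
    obtain ⟨w, hw, z, hz, rfl⟩ := ih hy
    exact ⟨j :: w, by simp [hw], z, hz, rfl⟩

/-- The iterate is a sum of nonnegative terms over all words of that length; the single word `u`
contributes at least the left-hand side. -/
theorem pow_length_mul_le_transfer_iterate [Fintype ι] {p : ι → X → ℝ} {f : ι → X → X} {ε : ℝ}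
    (hε : 0 ≤ ε) (hp : ∀ j x, ε ≤ p j x) (u : List ι) {G : X → ℝ} (hG : ∀ x, 0 ≤ G x) (x : X) :
    ε ^ u.length * G (wordMap f u x) ≤ (transfer p f)^[u.length] G x := by
  have hp0 : ∀ j x, 0 ≤ p j x := fun j x => hε.trans (hp j x)
  induction u generalizing G with
  | nil => simp [wordMap]
  | cons j u ih =>
    rw [List.length_cons, Function.iterate_succ_apply]
    refine le_trans ?_ (ih (transfer_iterate_nonneg hp0 1 hG))
    rw [pow_succ, mul_assoc]
    refine mul_le_mul_of_nonneg_left ?_ (by positivity)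
    calc ε * G (wordMap f (j :: u) x) ≤ p j (wordMap f u x) * G (f j (wordMap f u x)) :=
        mul_le_mul_of_nonneg_right (hp _ _) (hG _)
      _ ≤ _ := Finset.single_le_sum (f := fun j => p j (wordMap f u x) * G (f j (wordMap f u x)))
        (fun j _ => mul_nonneg (hp0 _ _) (hG _)) (Finset.mem_univ j)

end WordMap

/-! ### Measures fixed by the dual transfer operator. -/

theorem integrable_of_measurable_of_abs_le {X : Type*} [MeasurableSpace X] {μ : Measure X} [IsFiniteMeasure μ] {G : X → ℝ}
    (hG : Measurable G) {B : ℝ} (hB : ∀ x, |G x| ≤ B) : Integrable G μ :=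
  Integrable.of_bound hG.aestronglyMeasurable B (Eventually.of_forall hB)

theorem abs_transfer_iterate_le {ι X : Type*} [Fintype ι] {p : ι → X → ℝ} {f : ι → X → X}
    (hp : ∀ j x, 0 ≤ p j x) (hsum : ∀ x, ∑ j, p j x = 1) (n : ℕ)
    {G : X → ℝ} {B : ℝ} (hB : ∀ x, |G x| ≤ B) (x : X) : |(transfer p f)^[n] G x| ≤ B := by
  have h1 := (transfer_mono (f := f) hp).iterate n
    (show G ≤ fun _ => B from fun w => (abs_le.1 (hB w)).2) x
  have h2 := (transfer_mono (f := f) hp).iterate n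
    (show (fun _ => -B) ≤ G from fun w => (abs_le.1 (hB w)).1) x
  rw [transfer_iterate_const hsum] at h1 h2
  exact abs_le.2 ⟨h2, h1⟩

section Invariant

variable {ι X : Type*} [Fintype ι] [MetricSpace X] [MeasurableSpace X] [BorelSpace X]

/-- `μ` is a fixed point of the dual of the transfer operator. -/
def TransferInvariant (μ : Measure X) (p : ι → X → ℝ) (f : ι → X → X) : Prop :=
  ∀ G : X → ℝ, Measurable G → (∃ B, ∀ x, |G x| ≤ B) → ∫ x, transfer p f G x ∂μ = ∫ x, G x ∂μ

/-- The dual operator maps `μ` to the finite Borel measure `∑ j, (f j)_* (p j · μ)`. Continuous test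
functions identify it with `μ`, and the identity of measures then covers bounded measurable
functions. -/
theorem transferInvariant_of_continuous [CompactSpace X] {μ : Measure X} [IsFiniteMeasure μ] {p : ι → X → ℝ}
    {f : ι → X → X} (hf : ∀ j, Continuous (f j)) (hpc : ∀ j, Continuous (p j))
    (hp : ∀ j x, 0 ≤ p j x)
    (h : ∀ G : C(X, ℝ), ∫ x, transfer p f G x ∂μ = ∫ x, G x ∂μ) : TransferInvariant μ p f := by
  have hpb : ∀ j, ∃ B, ∀ x, |p j x| ≤ B := fun j => by
    obtain ⟨B, hB⟩ := isCompact_univ.exists_bound_of_continuousOn (hpc j).continuousOn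
    exact ⟨B, fun x => hB x (mem_univ x)⟩
  have hpi : ∀ j, Integrable (p j) μ := fun j => by
    obtain ⟨B, hB⟩ := hpb j
    exact integrable_of_measurable_of_abs_le (hpc j).measurable hB
  set κ : ι → Measure X := fun j => (μ.withDensity fun x => ENNReal.ofReal (p j x)).map (f j)
    with hκ
  have hfin : ∀ j, IsFiniteMeasure (κ j) := fun j => by
    have : IsFiniteMeasure (μ.withDensity fun x => ENNReal.ofReal (p j x)) :=
      isFiniteMeasure_withDensity_ofReal (hpi j).2
    infer_instance
  have hint : ∀ G : X → ℝ, Measurable G → (∃ B, ∀ x, |G x| ≤ B) →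
      ∫ x, G x ∂(∑ j, κ j) = ∫ x, transfer p f G x ∂μ := fun G hG ⟨B, hB⟩ => by
    rw [integral_finsetSum_measure fun j _ => integrable_of_measurable_of_abs_le hG hB]
    simp only [transfer]
    rw [integral_finsetSum]
    · refine Finset.sum_congr rfl fun j _ => ?_
      rw [hκ, integral_map (hf j).measurable.aemeasurable hG.aestronglyMeasurable,
        integral_withDensity_eq_integral_toReal_smul
          (hpc j).measurable.ennreal_ofReal (Eventually.of_forall fun _ => ENNReal.ofReal_lt_top)]
      refine integral_congr_ae (Eventually.of_forall fun x => ?_)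
      simp [ENNReal.toReal_ofReal (hp j x)]
    · intro j _
      obtain ⟨B', hB'⟩ := hpb j
      refine integrable_of_measurable_of_abs_le (B := B' * B)
        ((hpc j).measurable.mul (hG.comp (hf j).measurable)) fun x => ?_
      rw [abs_mul]
      exact mul_le_mul (hB' x) (hB _) (abs_nonneg _) ((abs_nonneg _).trans (hB' x))
  have hμ : μ = ∑ j, κ j := by
    refine ext_of_forall_integral_eq_of_IsFiniteMeasure fun G => ?_
    rw [hint G G.continuous.measurable ⟨‖G‖, G.norm_coe_le_norm⟩]
    exact (h G.toContinuousMap).symm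
  intro G hG hB
  conv_rhs => rw [hμ]
  exact (hint G hG hB).symm

variable {μ : Measure X} {p : ι → X → ℝ} {f : ι → X → X}

theorem measurable_transfer_iterate (hf : ∀ j, Continuous (f j)) (hpc : ∀ j, Continuous (p j))
    (n : ℕ) {G : X → ℝ} (hG : Measurable G) : Measurable ((transfer p f)^[n] G) := by
  induction n with
  | zero => exact hG
  | succ n ih =>
    rw [Function.iterate_succ_apply']
    exact Finset.measurable_fun_sum _ fun j _ =>
      (hpc j).measurable.mul (ih.comp (hf j).measurable)

theorem TransferInvariant.iterate (h : TransferInvariant μ p f) (hf : ∀ j, Continuous (f j))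
    (hpc : ∀ j, Continuous (p j)) (hp : ∀ j x, 0 ≤ p j x) (hsum : ∀ x, ∑ j, p j x = 1) (n : ℕ)
    {G : X → ℝ} (hG : Measurable G) {B : ℝ} (hB : ∀ x, |G x| ≤ B) :
    ∫ x, (transfer p f)^[n] G x ∂μ = ∫ x, G x ∂μ := by
  induction n with
  | zero => rfl
  | succ n ih =>
    rw [Function.iterate_succ_apply', h _ (measurable_transfer_iterate hf hpc n hG)
      ⟨B, abs_transfer_iterate_le hp hsum n hB⟩, ih]

/-- Duality between the transfer operator and a map `T` that is almost everywhere a left inverse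
of the maps `f j`. -/
theorem TransferInvariant.integral_mul_comp_iterate (h : TransferInvariant μ p f)
    (hf : ∀ j, Continuous (f j)) (hpc : ∀ j, Continuous (p j)) (hp : ∀ j x, 0 ≤ p j x)
    (hsum : ∀ x, ∑ j, p j x = 1) {Y : Type*} [MeasurableSpace Y] {T : Y → Y} (hT : Measurable T)
    {e : X → Y} (he : Measurable e) (hTf : ∀ᵐ x ∂μ, ∀ j, T (e (f j x)) = e x) (n : ℕ)
    {u : X → ℝ} (hu : Measurable u) {B : ℝ} (hB : ∀ x, |u x| ≤ B) {G : Y → ℝ}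
    (hG : Measurable G) {B' : ℝ} (hB' : ∀ y, |G y| ≤ B') :
    ∫ x, u x * G (T^[n] (e x)) ∂μ = ∫ x, (transfer p f)^[n] u x * G (e x) ∂μ := by
  induction n generalizing u with
  | zero => rfl
  | succ n ih =>
    have hT' : Measurable fun x => G (T^[n] (T (e x))) :=
      hG.comp ((hT.iterate n).comp (hT.comp he))
    calc ∫ x, u x * G (T^[n + 1] (e x)) ∂μ
        = ∫ x, transfer p f (fun y => u y * G (T^[n] (T (e y)))) x ∂μ := by
          refine (h _ (hu.mul hT') ⟨B * B', fun x => ?_⟩).symm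
          rw [Pi.mul_apply, abs_mul]
          exact mul_le_mul (hB x) (hB' _) (abs_nonneg _) ((abs_nonneg _).trans (hB x))
      _ = ∫ x, transfer p f u x * G (T^[n] (e x)) ∂μ := by
          refine integral_congr_ae ?_
          filter_upwards [hTf] with x hx
          simp only [transfer, hx, Finset.sum_mul, mul_assoc]
      _ = _ := by
          exact ih (measurable_transfer_iterate hf hpc 1 hu)
            (abs_transfer_iterate_le hp hsum 1 hB)

variable [IsFiniteMeasure μ]

/-- The measure of a set is bounded through that of a set controlling its preimages. -/
theorem TransferInvariant.measureReal_le (h : TransferInvariant μ p f)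
    (hf : ∀ j, Continuous (f j)) (hpc : ∀ j, Continuous (p j)) (hp : ∀ j x, 0 ≤ p j x)
    (hsum : ∀ x, ∑ j, p j x = 1) (n : ℕ) {S S' : Set X} (hS : MeasurableSet S)
    (hS' : MeasurableSet S') {a : ℝ}
    (hle : ∀ x, (transfer p f)^[n] (S.indicator 1) x ≤ a * S'.indicator 1 x) :
    μ.real S ≤ a * μ.real S' := by
  have hb : ∀ (S : Set X) x, |S.indicator (1 : X → ℝ) x| ≤ 1 := fun S x => by
    by_cases hx : x ∈ S <;> simp [hx]
  have hm : ∀ {S : Set X}, MeasurableSet S → Measurable (S.indicator (1 : X → ℝ)) := fun hS =>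
    measurable_one.indicator hS
  calc μ.real S = ∫ x, S.indicator 1 x ∂μ := (integral_indicator_one hS).symm
    _ = ∫ x, (transfer p f)^[n] (S.indicator 1) x ∂μ :=
      (h.iterate hf hpc hp hsum n (hm hS) (hb S)).symm
    _ ≤ ∫ x, a * S'.indicator 1 x ∂μ := integral_mono
      (integrable_of_measurable_of_abs_le (measurable_transfer_iterate hf hpc n (hm hS))
        (abs_transfer_iterate_le hp hsum n (hb S)))
      ((integrable_of_measurable_of_abs_le (hm hS') (hb S')).const_mul a) hle
    _ = a * μ.real S' := by rw [integral_const_mul, integral_indicator_one hS']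

/-- Almost every point has, for every `k`, a coding in which a given word `u` occurs after
position `k`. -/
theorem TransferInvariant.ae_exists_mem_range_wordMap [CompactSpace X] (h : TransferInvariant μ p f)
    (hf : ∀ j, Continuous (f j)) (hpc : ∀ j, Continuous (p j)) {ε : ℝ} (hε : 0 < ε)
    (hp : ∀ j x, ε ≤ p j x) (hsum : ∀ x, ∑ j, p j x = 1) (u : List ι) :
    ∀ᵐ x ∂μ, ∀ k, ∃ w w' : List ι, w.length = k ∧ x ∈ range (wordMap f (w ++ w' ++ u)) := by
  have hp0 : ∀ j x, 0 ≤ p j x := fun j x => hε.le.trans (hp j x)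
  rw [ae_all_iff]
  set U : ℕ → Set X := fun k =>
    ⋃ (w : List ι) (w' : List ι) (_ : w.length = k), range (wordMap f (w ++ w' ++ u)) with hU
  have hUm : ∀ k, MeasurableSet (U k) := fun k =>
    MeasurableSet.iUnion fun w => MeasurableSet.iUnion fun w' => MeasurableSet.iUnion fun _ =>
      (isCompact_range (wordMap_continuous hf _)).measurableSet
  have hmem : ∀ k x, x ∈ U k ↔
      ∃ w w' : List ι, w.length = k ∧ x ∈ range (wordMap f (w ++ w' ++ u)) := fun k x => by
    simp only [hU, mem_iUnion, exists_prop]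
  have hsucc : ∀ k j x, x ∈ U k → f j x ∈ U (k + 1) := fun k j x hx => by
    obtain ⟨w, w', hw, y, rfl⟩ := (hmem _ _).1 hx
    exact (hmem _ _).2 ⟨j :: w, w', by simp [hw], y, rfl⟩
  have hzero : ∀ j x, x ∈ U 0 → f j x ∈ U 0 := fun j x hx => by
    obtain ⟨w, w', hw, y, rfl⟩ := (hmem _ _).1 hx
    obtain rfl := List.length_eq_zero_iff.1 hw
    exact (hmem _ _).2 ⟨[], j :: w', rfl, y, rfl⟩
  -- If all branches map `U k` into `U k'`, then averaging the indicator of the complement of `U k'`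
  -- gives 0 on `U k` and at most 1 elsewhere.
  have hstep : ∀ k k', (∀ j x, x ∈ U k → f j x ∈ U k') → ∀ x,
      transfer p f ((U k')ᶜ.indicator 1) x ≤ (U k)ᶜ.indicator 1 x := fun k k' hkk' x => by
    by_cases hx : x ∈ U k
    · have : ∀ j, f j x ∈ U k' := fun j => hkk' j x hx
      simp [transfer, hx, this]
    · have := transfer_iterate_le_one (f := f) hp0 hsum 1 (G := (U k')ᶜ.indicator 1)
        (fun x => by by_cases hx : x ∈ U k' <;> simp [hx]) x
      simpa [hx] using this
  have h0 : μ.real (U 0)ᶜ = 0 := by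
    have hmono : ∀ n, (transfer p f)^[n] ((U 0)ᶜ.indicator 1) ≤ (U 0)ᶜ.indicator 1 := fun n => by
      induction n with
      | zero => exact le_rfl
      | succ n ih =>
        rw [Function.iterate_succ_apply']
        exact (transfer_mono hp0 ih).trans (hstep 0 0 hzero)
    -- From any point outside `U 0` the branch `u` leads into `U 0` with weight at least `ε ^
    -- u.length`. The complement therefore has measure at most `1 - ε ^ u.length` times itself,
    -- hence zero.
    have hle := h.measureReal_le hf hpc hp0 hsum u.length (hUm 0).compl (hUm 0).compl
      (a := 1 - ε ^ u.length) fun x => by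
        by_cases hx : x ∈ U 0
        · have := hmono u.length x
          simpa [hx] using this
        · have h1 := pow_length_mul_le_transfer_iterate (f := f) hε.le hp u
            (G := (U 0).indicator 1) (fun x => indicator_nonneg (fun _ _ => zero_le_one) x) x
          have hux : wordMap f u x ∈ U 0 := (hmem _ _).2 ⟨[], [], rfl, x, rfl⟩
          have h2 : ((U 0)ᶜ.indicator 1 : X → ℝ) = fun y => -1 * (U 0).indicator 1 y + 1 := by
            ext y
            by_cases hy : y ∈ U 0 <;> simp [hy]
          rw [h2, transfer_iterate_affine hsum]
          simp only [hux, indicator_of_mem, Pi.one_apply, mul_one] at h1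
          simp only [hx, not_false_eq_true, indicator_of_notMem, mul_zero, zero_add, mul_one]
          linarith
    have hpos : 0 < ε ^ u.length := by positivity
    have := measureReal_nonneg (μ := μ) (s := (U 0)ᶜ)
    nlinarith
  intro k
  have hk : μ.real (U k)ᶜ = 0 := by
    induction k with
    | zero => exact h0
    | succ k ih =>
      have hle := h.measureReal_le hf hpc hp0 hsum 1 (hUm (k + 1)).compl (hUm k).compl (a := 1)
        fun x => by
          rw [one_mul]
          exact hstep k (k + 1) (hsucc k) x
      rw [ih, mul_zero] at hle
      exact le_antisymm hle measureReal_nonneg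
  rw [measureReal_eq_zero_iff] at hk
  filter_upwards [compl_mem_ae_iff.2 hk] with x hx
  exact (hmem k x).1 (not_not.1 hx)

/-- For a null set `N`, invariance gives `∫ P 1_N dμ = 0`; since the weights are strictly positive,
almost no point has an image in `N` under any branch. -/
theorem TransferInvariant.ae_comp (h : TransferInvariant μ p f)
    (hf : ∀ j, Continuous (f j)) (hpc : ∀ j, Continuous (p j)) (hp : ∀ j x, 0 < p j x)
    (hsum : ∀ x, ∑ j, p j x = 1) {q : X → Prop} (hq : ∀ᵐ x ∂μ, q x) :
    ∀ᵐ x ∂μ, ∀ j, q (f j x) := by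
  obtain ⟨N, hqN, hNm, hN0⟩ := exists_measurable_superset_of_null (ae_iff.1 hq)
  have hb : ∀ x, |N.indicator (1 : X → ℝ) x| ≤ 1 := fun x => by
    by_cases hx : x ∈ N <;> simp [hx]
  have hm : Measurable (N.indicator (1 : X → ℝ)) := measurable_one.indicator hNm
  have hp0 : ∀ j x, 0 ≤ p j x := fun j x => (hp j x).le
  have hnn : ∀ x, 0 ≤ N.indicator (1 : X → ℝ) x := indicator_nonneg fun _ _ => zero_le_one
  have hint : ∫ x, transfer p f (N.indicator 1) x ∂μ = 0 := by
    rw [h _ hm ⟨1, hb⟩, integral_indicator_one hNm, measureReal_eq_zero_iff, hN0]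
  rw [integral_eq_zero_iff_of_nonneg (f := transfer p f (N.indicator 1)) (transfer_iterate_nonneg hp0 1 hnn)
    (integrable_of_measurable_of_abs_le (measurable_transfer_iterate hf hpc 1 hm)
      (abs_transfer_iterate_le hp0 hsum 1 hb))] at hint
  filter_upwards [hint] with x hx j
  by_contra hj
  have hjN : f j x ∈ N := hqN hj
  have : p j x * N.indicator 1 (f j x) ≤ transfer p f (N.indicator 1) x :=
    Finset.single_le_sum (f := fun j => p j x * N.indicator 1 (f j x))
      (fun j _ => mul_nonneg (hp0 _ _) (hnn _)) (Finset.mem_univ j)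
  rw [hx] at this
  simp only [hjN, indicator_of_mem, Pi.one_apply, mul_one, Pi.zero_apply] at this
  linarith [hp j x]

end Invariant

/-- A lower bound `κ` turns an additive error into a relative one, and `1 + t ≤ exp t` puts it in
the multiplicative form that accumulates along compositions. -/
theorem HolderOnWith.le_exp_mul {X : Type*} [PseudoMetricSpace X] {C r : ℝ≥0} {f : X → ℝ}
    {s : Set X} (hf : HolderOnWith C r f s) {κ : ℝ} (hκ : 0 < κ) (hle : ∀ x ∈ s, κ ≤ f x)
    {x y : X} (hx : x ∈ s) (hy : y ∈ s) :
    f x ≤ Real.exp (C / κ * dist x y ^ (r : ℝ)) * f y := by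
  have h1 := (abs_le.1 ((Real.dist_eq _ _).symm.trans_le (hf.dist_le hx hy))).2
  have h2 : 0 ≤ C / κ * dist x y ^ (r : ℝ) := by positivity
  calc f x ≤ C * dist x y ^ (r : ℝ) + f y := by linarith
    _ = (C / κ * dist x y ^ (r : ℝ)) * κ + f y := by field_simp
    _ ≤ (C / κ * dist x y ^ (r : ℝ)) * f y + f y := by
      have := mul_le_mul_of_nonneg_left (hle y hy) h2
      linarith
    _ = (C / κ * dist x y ^ (r : ℝ) + 1) * f y := by ring
    _ ≤ _ := mul_le_mul_of_nonneg_right (Real.add_one_le_exp _) (hκ.le.trans (hle y hy))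

/-- Such a map is bijective and carries the closed unit ball onto the closed ball of radius `r`;
comparing volumes gives the determinant. -/
theorem abs_det_eq_pow_of_norm_apply {d : ℕ} (A : Euc d →L[ℝ] Euc d) {r : ℝ} (hr : 0 < r)
    (hA : ∀ y, ‖A y‖ = r * ‖y‖) : |A.det| = r ^ d := by
  have hinj : Function.Injective A.toLinearMap := by
    rw [injective_iff_map_eq_zero]
    intro y hy
    have h := hA y
    rw [show A y = 0 from hy, norm_zero] at h
    exact norm_eq_zero.1 ((mul_eq_zero.1 h.symm).resolve_left hr.ne')
  have hsurj := LinearMap.surjective_of_injective hinj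
  have himg : A.toLinearMap '' Metric.closedBall 0 1 = Metric.closedBall 0 r := by
    ext z
    constructor
    · rintro ⟨y, hy, rfl⟩
      rw [mem_closedBall_zero_iff] at hy ⊢
      have := hA y
      simp only [ContinuousLinearMap.coe_coe]
      nlinarith
    · intro hz
      obtain ⟨y, rfl⟩ := hsurj z
      refine ⟨y, ?_, rfl⟩
      rw [mem_closedBall_zero_iff] at hz ⊢
      simp only [ContinuousLinearMap.coe_coe] at hz
      rw [hA y] at hz
      exact le_of_mul_le_mul_left (by linarith) hr
  have h := Measure.addHaar_image_linearMap (volume : Measure (Euc d)) A.toLinearMap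
    (Metric.closedBall 0 1)
  rw [himg, Measure.addHaar_closedBall' _ _ hr.le] at h
  have hpos : volume (Metric.closedBall (0 : Euc d) 1) ≠ 0 :=
    (Metric.measure_closedBall_pos volume _ one_pos).ne'
  have h2 := (ENNReal.mul_left_inj hpos measure_closedBall_lt_top.ne).1 h
  rw [finrank_euclideanSpace_fin, ENNReal.ofReal_eq_ofReal_iff (by positivity) (abs_nonneg _)] at h2
  exact h2.symm

/-! ### Dilation factors, distortion and diameters of cylinders. -/

namespace ConformalIFS

variable {d m : ℕ} (Φ : ConformalIFS d m)

theorem nonempty_index (Φ : ConformalIFS d m) : Nonempty (Fin m) := ⟨⟨0, by have := Φ.two_le; omega⟩⟩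

theorem mapsTo (j : Fin m) : MapsTo (Φ.φ j) Φ.Ω Φ.Ω := fun _ hx =>
  Φ.closure_image_subset j (subset_closure (mem_image_of_mem _ hx))

theorem exists_contraction : ∃ c : ℝ, 0 < c ∧ c < 1 ∧ ∀ j, ∀ x ∈ Φ.Ω, ∀ y ∈ Φ.Ω,
    dist (Φ.φ j x) (Φ.φ j y) ≤ c * dist x y := by
  have := Φ.nonempty_index
  choose c hc hl using Φ.contractive
  obtain ⟨j₀, hj₀⟩ := Finite.exists_max c
  refine ⟨max (c j₀) (1 / 2), by positivity, max_lt (hc j₀) (by norm_num), fun j x hx y hy => ?_⟩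
  refine ((hl j).dist_le_mul x hx y hy).trans (mul_le_mul_of_nonneg_right ?_ dist_nonneg)
  exact le_max_of_le_left (hj₀ j)

theorem exists_deriv_bounds : ∃ κ b : ℝ, 0 < κ ∧ 0 < b ∧ b < 1 ∧ ∀ j, ∀ x ∈ Φ.Ω,
    κ ≤ ‖fderiv ℝ (Φ.φ j) x‖ ∧ ‖fderiv ℝ (Φ.φ j) x‖ ≤ b := by
  have := Φ.nonempty_index
  choose a ha hal using Φ.deriv_lower
  choose b hb hbu using Φ.deriv_upper
  obtain ⟨i, hi⟩ := Finite.exists_min a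
  obtain ⟨k, hk⟩ := Finite.exists_max b
  exact ⟨a i, max (b k) (1 / 2), ha i, by positivity, max_lt (hb k) (by norm_num),
    fun j x hx => ⟨(hi j).trans (hal j x hx),
      (hbu j x hx).trans ((hk j).trans (le_max_left _ _))⟩⟩

/-- The dilation factor of `φ_{i_1} ∘ ⋯ ∘ φ_{i_n}` at a point. -/
noncomputable def wordDeriv : List (Fin m) → Euc d → ℝ
  | [], _ => 1
  | j :: w, x => ‖fderiv ℝ (Φ.φ j) (wordMap Φ.φ w x)‖ * wordDeriv w x

theorem wordDeriv_append (w v : List (Fin m)) (x : Euc d) :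
    Φ.wordDeriv (w ++ v) x = Φ.wordDeriv w (wordMap Φ.φ v x) * Φ.wordDeriv v x := by
  induction w with
  | nil => simp [wordDeriv]
  | cons j w ih => rw [List.cons_append, wordDeriv, wordDeriv, ih, wordMap_append, mul_assoc]

theorem wordMap_mem (w : List (Fin m)) {x : Euc d} (hx : x ∈ Φ.Ω) : wordMap Φ.φ w x ∈ Φ.Ω :=
  wordMap_mapsTo Φ.mapsTo w hx

theorem pow_length_le_wordDeriv {κ : ℝ} (hκ : 0 ≤ κ)
    (h : ∀ j, ∀ x ∈ Φ.Ω, κ ≤ ‖fderiv ℝ (Φ.φ j) x‖) (w : List (Fin m)) {x : Euc d}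
    (hx : x ∈ Φ.Ω) : κ ^ w.length ≤ Φ.wordDeriv w x := by
  induction w with
  | nil => simp [wordDeriv]
  | cons j w ih =>
    rw [List.length_cons, pow_succ', wordDeriv]
    exact mul_le_mul (h j _ (Φ.wordMap_mem w hx)) ih (by positivity) (norm_nonneg _)

theorem wordDeriv_nonneg (w : List (Fin m)) (x : Euc d) : 0 ≤ Φ.wordDeriv w x := by
  induction w with
  | nil => exact zero_le_one
  | cons j w ih => exact mul_nonneg (norm_nonneg _) ih

theorem wordDeriv_pos (w : List (Fin m)) {x : Euc d} (hx : x ∈ Φ.Ω) : 0 < Φ.wordDeriv w x := by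
  obtain ⟨κ, b, hκ, -, -, h⟩ := Φ.exists_deriv_bounds
  exact (pow_pos hκ _).trans_le (Φ.pow_length_le_wordDeriv hκ.le (fun j x hx => (h j x hx).1) w hx)

theorem wordDeriv_le_pow_length {b : ℝ} (hb : 0 ≤ b)
    (h : ∀ j, ∀ x ∈ Φ.Ω, ‖fderiv ℝ (Φ.φ j) x‖ ≤ b) (w : List (Fin m)) {x : Euc d}
    (hx : x ∈ Φ.Ω) : Φ.wordDeriv w x ≤ b ^ w.length := by
  induction w with
  | nil => simp [wordDeriv]
  | cons j w ih =>
    rw [List.length_cons, pow_succ', wordDeriv]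
    exact mul_le_mul (h j _ (Φ.wordMap_mem w hx)) ih (Φ.wordDeriv_nonneg _ _) hb

theorem hasFDerivAt_wordMap (w : List (Fin m)) {x : Euc d} (hx : x ∈ Φ.Ω) :
    ∃ A : Euc d →L[ℝ] Euc d, HasFDerivAt (wordMap Φ.φ w) A x ∧
      ∀ y, ‖A y‖ = Φ.wordDeriv w x * ‖y‖ := by
  induction w with
  | nil => exact ⟨_, hasFDerivAt_id x, fun y => by simp [wordDeriv]⟩
  | cons j w ih =>
    obtain ⟨A, hA, hAn⟩ := ih
    have hw := Φ.wordMap_mem w hx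
    have hdiff : DifferentiableAt ℝ (Φ.φ j) (wordMap Φ.φ w x) :=
      ((Φ.conformal j).contDiffOn.contDiffAt (Φ.isOpen.mem_nhds hw)).differentiableAt one_ne_zero
    refine ⟨_, hdiff.hasFDerivAt.comp x hA, fun y => ?_⟩
    rw [ContinuousLinearMap.comp_apply, (Φ.conformal j).norm_fderiv_apply _ hw, hAn, wordDeriv,
      mul_assoc]

/-- Bounded distortion. -/
theorem exists_distortion {α : ℝ≥0} (hα : Φ.IsC1Holder α) : ∃ A : ℝ, 1 ≤ A ∧
    ∀ w, ∀ x ∈ Φ.Ω, ∀ y ∈ Φ.Ω, Φ.wordDeriv w x ≤ A * Φ.wordDeriv w y := by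
  have := Φ.nonempty_index
  obtain ⟨c, hc, hc1, hcφ⟩ := Φ.exists_contraction
  obtain ⟨κ, b, hκ, -, -, hb⟩ := Φ.exists_deriv_bounds
  obtain ⟨hα0, hα⟩ := hα
  choose H hH using hα
  obtain ⟨i, hi⟩ := Finite.exists_max H
  have hα0' : (0 : ℝ) < α := hα0
  set C : ℝ := H i / κ with hC
  have hC0 : 0 ≤ C := by positivity
  have h1 : 0 < 1 - c ^ (α : ℝ) := sub_pos.2 (Real.rpow_lt_one hc.le hc1 hα0')
  have ha : ∀ j, ∀ x ∈ Φ.Ω, ∀ y ∈ Φ.Ω, ‖fderiv ℝ (Φ.φ j) x‖ ≤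
      Real.exp (C * dist x y ^ (α : ℝ)) * ‖fderiv ℝ (Φ.φ j) y‖ := fun j x hx y hy => by
    refine ((hH j).le_exp_mul hκ (fun x hx => (hb j x hx).1) hx hy).trans ?_
    have : (H j : ℝ) ≤ H i := hi j
    rw [hC]
    gcongr
  have hD : ∀ w : List (Fin m), ∀ x ∈ Φ.Ω, ∀ y ∈ Φ.Ω, Φ.wordDeriv w x ≤
      Real.exp (C / (1 - c ^ (α : ℝ)) * dist x y ^ (α : ℝ)) * Φ.wordDeriv w y := by
    intro w
    -- The last letter acts first, so the points at which the factor of `w` is compared are already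
    -- contracted by `φ_j`; this gives the geometric series.
    induction w using List.reverseRecOn with
    | nil =>
      intro x _ y _
      simp only [wordDeriv, mul_one]
      exact Real.one_le_exp (by positivity)
    | append_singleton w j ih =>
      intro x hx y hy
      have e : ∀ z, Φ.wordDeriv (w ++ [j]) z =
          Φ.wordDeriv w (Φ.φ j z) * ‖fderiv ℝ (Φ.φ j) z‖ := fun z => by
        rw [wordDeriv_append]
        simp [wordDeriv, wordMap]
      rw [e, e]
      calc _ ≤ (Real.exp (C / (1 - c ^ (α : ℝ)) * dist (Φ.φ j x) (Φ.φ j y) ^ (α : ℝ)) *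
            Φ.wordDeriv w (Φ.φ j y)) *
            (Real.exp (C * dist x y ^ (α : ℝ)) * ‖fderiv ℝ (Φ.φ j) y‖) :=
            mul_le_mul (ih _ (Φ.mapsTo j hx) _ (Φ.mapsTo j hy)) (ha j x hx y hy) (norm_nonneg _)
              (mul_nonneg (Real.exp_pos _).le (Φ.wordDeriv_nonneg _ _))
        _ = Real.exp (C * dist x y ^ (α : ℝ) +
              C / (1 - c ^ (α : ℝ)) * dist (Φ.φ j x) (Φ.φ j y) ^ (α : ℝ)) *
            (Φ.wordDeriv w (Φ.φ j y) * ‖fderiv ℝ (Φ.φ j) y‖) := by rw [Real.exp_add]; ring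
        _ ≤ _ := by
          refine mul_le_mul_of_nonneg_right (Real.exp_le_exp.2 ?_)
            (mul_nonneg (Φ.wordDeriv_nonneg _ _) (norm_nonneg _))
          exact distortion_combine hc hc1 hα0' hC0 dist_nonneg dist_nonneg (hcφ j x hx y hy)
  refine ⟨Real.exp (C / (1 - c ^ (α : ℝ)) * Metric.diam Φ.Ω ^ (α : ℝ)),
    Real.one_le_exp (by have := Metric.diam_nonneg (s := Φ.Ω); positivity),
    fun w x hx y hy => (hD w x hx y hy).trans ?_⟩
  refine mul_le_mul_of_nonneg_right (Real.exp_le_exp.2 ?_) (Φ.wordDeriv_nonneg _ _)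
  have := Metric.dist_le_diam_of_mem Φ.isBounded hx hy
  gcongr

theorem dist_wordMap_le {c : ℝ} (hc : 0 ≤ c) (hcφ : ∀ j, ∀ x ∈ Φ.Ω, ∀ y ∈ Φ.Ω,
    dist (Φ.φ j x) (Φ.φ j y) ≤ c * dist x y) (w : List (Fin m)) {x y : Euc d} (hx : x ∈ Φ.Ω)
    (hy : y ∈ Φ.Ω) : dist (wordMap Φ.φ w x) (wordMap Φ.φ w y) ≤ c ^ w.length * dist x y := by
  induction w with
  | nil => simp [wordMap]
  | cons j w ih =>
    rw [List.length_cons, pow_succ', mul_assoc]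
    exact (hcφ j _ (Φ.wordMap_mem w hx) _ (Φ.wordMap_mem w hy)).trans
      (mul_le_mul_of_nonneg_left ih hc)

/-- The diameter of `φ_w(Ω)` is comparable to the derivative of `φ_w`. -/
theorem exists_dist_wordMap_le {α : ℝ≥0} (hα : Φ.IsC1Holder α) : ∃ B : ℝ, 0 < B ∧
    ∀ w, ∀ x ∈ Φ.Ω, ∀ y ∈ Φ.Ω, ∀ z ∈ Φ.Ω,
      dist (wordMap Φ.φ w x) (wordMap Φ.φ w y) ≤ B * Φ.wordDeriv w z := by
  obtain ⟨c, hc, hc1, hcφ⟩ := Φ.exists_contraction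
  obtain ⟨κ, b, hκ, hb0, hb1, hb⟩ := Φ.exists_deriv_bounds
  obtain ⟨A, hA1, hA⟩ := Φ.exists_distortion hα
  have hA0 : 0 < A := by linarith
  set X := ⋃ j, closure (Φ.φ j '' Φ.Ω) with hX
  have hXc : IsCompact X := isCompact_iUnion fun j =>
    (Φ.isBounded.subset ((subset_closure).trans (Φ.closure_image_subset j))).isCompact_closure
  have hXΩ : X ⊆ Φ.Ω := iUnion_subset Φ.closure_image_subset
  -- `Ω` need not be convex, so the mean value inequality is used only in balls of radius `η` around
  -- points of `X`, which lie in `Ω`.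
  obtain ⟨η, hη, hηΩ⟩ := hXc.exists_thickening_subset_open Φ.isOpen hXΩ
  set Δ := Metric.diam Φ.Ω with hΔ
  have hΔ0 : 0 ≤ Δ := Metric.diam_nonneg
  have hdΔ : ∀ x ∈ Φ.Ω, ∀ y ∈ Φ.Ω, dist x y ≤ Δ := fun x hx y hy =>
    Metric.dist_le_diam_of_mem Φ.isBounded hx hy
  -- The innermost `N + 1` letters shrink `Ω` below `η`; the exponent is positive so that this block
  -- is non-empty and its image lies in `X`. Shorter words are handled by the crude bound `κ ^ (N +
  -- 1)`.
  obtain ⟨N, hN⟩ : ∃ N : ℕ, c ^ (N + 1) * Δ < η := by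
    have : Tendsto (fun N : ℕ => c ^ (N + 1) * Δ) atTop (𝓝 (0 * Δ)) :=
      ((tendsto_pow_atTop_nhds_zero_of_lt_one hc.le hc1).comp (tendsto_add_atTop_nat 1)).mul_const _
    rw [zero_mul] at this
    exact (this.eventually_lt_const hη).exists
  have hκ1 : κ ≤ 1 := by
    obtain ⟨j⟩ := Φ.nonempty_index
    obtain ⟨x, hx⟩ := Φ.isConnected.nonempty
    linarith [(hb j x hx).1, (hb j x hx).2]
  have hκN : 0 < κ ^ (N + 1) := pow_pos hκ _
  refine ⟨(A * A * η + Δ) / κ ^ (N + 1), by positivity, fun w x hx y hy z hz => ?_⟩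
  have hDz := Φ.pow_length_le_wordDeriv hκ.le (fun j x hx => (hb j x hx).1) w hz
  rcases le_total w.length (N + 1) with hw | hw
  · have h1 : κ ^ (N + 1) ≤ Φ.wordDeriv w z :=
      (pow_le_pow_of_le_one hκ.le hκ1 hw).trans hDz
    calc _ ≤ Δ := hdΔ _ (Φ.wordMap_mem w hx) _ (Φ.wordMap_mem w hy)
      _ ≤ A * A * η + Δ := by have : 0 ≤ A * A * η := by positivity
                              linarith
      _ = (A * A * η + Δ) / κ ^ (N + 1) * κ ^ (N + 1) := by field_simp
      _ ≤ _ := by gcongr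
  · obtain ⟨w₀, w₁, rfl, hw₁⟩ : ∃ w₀ w₁, w = w₀ ++ w₁ ∧ w₁.length = N + 1 :=
      ⟨w.take (w.length - (N + 1)), w.drop (w.length - (N + 1)), (List.take_append_drop _ _).symm,
        by simp; omega⟩
    obtain ⟨j, v, rfl⟩ : ∃ j v, w₁ = j :: v := by
      cases w₁ with
      | nil => simp at hw₁
      | cons j v => exact ⟨j, v, rfl⟩
    set x' := wordMap Φ.φ (j :: v) x with hx'
    set y' := wordMap Φ.φ (j :: v) y with hy'
    have hxX : x' ∈ X :=
      mem_iUnion.2 ⟨j, subset_closure (mem_image_of_mem _ (Φ.wordMap_mem v hx))⟩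
    have hxy : dist y' x' < η := by
      refine (Φ.dist_wordMap_le hc.le hcφ _ hy hx).trans_lt (lt_of_le_of_lt ?_ hN)
      rw [hw₁]
      exact mul_le_mul_of_nonneg_left (hdΔ _ hy _ hx) (by positivity)
    have hball : Metric.ball x' η ⊆ Φ.Ω := fun p hp =>
      hηΩ (Metric.mem_thickening_iff.2 ⟨x', hxX, hp⟩)
    choose! F hF hFn using fun p (hp : p ∈ Φ.Ω) => Φ.hasFDerivAt_wordMap w₀ hp
    have hz' := Φ.wordMap_mem (j :: v) hz
    have hmv := (convex_ball x' η).norm_image_sub_le_of_norm_hasFDerivWithin_le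
      (f := wordMap Φ.φ w₀) (f' := F) (C := A * Φ.wordDeriv w₀ (wordMap Φ.φ (j :: v) z))
      (fun p hp => (hF p (hball hp)).hasFDerivWithinAt)
      (fun p hp => ContinuousLinearMap.opNorm_le_bound _
        (mul_nonneg hA0.le (Φ.wordDeriv_nonneg _ _)) fun q => by
          rw [hFn p (hball hp)]
          exact mul_le_mul_of_nonneg_right (hA _ _ (hball hp) _ hz') (norm_nonneg q))
      (show y' ∈ Metric.ball x' η from hxy) (Metric.mem_ball_self hη)
    rw [← dist_eq_norm, ← dist_eq_norm] at hmv
    have h0 := Φ.wordDeriv_nonneg w₀ (wordMap Φ.φ (j :: v) z)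
    have h1 : κ ^ (N + 1) ≤ Φ.wordDeriv (j :: v) z := by
      rw [← hw₁]
      exact Φ.pow_length_le_wordDeriv hκ.le (fun j x hx => (hb j x hx).1) _ hz
    rw [wordMap_append, wordMap_append, wordDeriv_append, ← hx', ← hy']
    calc _ ≤ A * Φ.wordDeriv w₀ (wordMap Φ.φ (j :: v) z) * dist x' y' := hmv
      _ ≤ A * Φ.wordDeriv w₀ (wordMap Φ.φ (j :: v) z) * η := by
        rw [dist_comm]; gcongr
      _ ≤ A * Φ.wordDeriv w₀ (wordMap Φ.φ (j :: v) z) * (A * η) := by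
        gcongr
        nlinarith
      _ = (A * A * η) / κ ^ (N + 1) *
          (Φ.wordDeriv w₀ (wordMap Φ.φ (j :: v) z) * κ ^ (N + 1)) := by field_simp
      _ ≤ (A * A * η + Δ) / κ ^ (N + 1) *
          (Φ.wordDeriv w₀ (wordMap Φ.φ (j :: v) z) * Φ.wordDeriv (j :: v) z) := by
        gcongr
        linarith

/-- Change of variables: conformality makes the Jacobian the `d`-th power of the dilation factor. -/
theorem le_volume_image_wordMap (w : List (Fin m)) {S : Set (Euc d)} (hS : MeasurableSet S)
    (hSΩ : S ⊆ Φ.Ω) {r : ℝ} (hr : 0 ≤ r) (h : ∀ x ∈ S, r ≤ Φ.wordDeriv w x) :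
    ENNReal.ofReal (r ^ d) * volume S ≤ volume (wordMap Φ.φ w '' S) := by
  choose! F hF hFn using fun p (hp : p ∈ Φ.Ω) => Φ.hasFDerivAt_wordMap w hp
  rw [← lintegral_abs_det_fderiv_eq_addHaar_image volume hS
    (fun x hx => (hF x (hSΩ hx)).hasFDerivWithinAt)
    ((wordMap_injOn Φ.mapsTo (fun j => (Φ.conformal j).injOn) w).mono hSΩ), ← setLIntegral_const]
  refine setLIntegral_mono' hS fun x hx => ENNReal.ofReal_le_ofReal ?_
  rw [abs_det_eq_pow_of_norm_apply (F x) (Φ.wordDeriv_pos w (hSΩ hx)) (hFn x (hSΩ hx))]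
  exact pow_le_pow_left₀ hr (h x hx) d

end ConformalIFS

/-! ### The open set condition: counting neighbours and a separating word. -/

namespace ConformalIFS

variable {d m : ℕ} (Φ : ConformalIFS d m)

/-- Injectivity strips common first letters; at the first disagreement the two points would lie in
disjoint images of `V`. -/
theorem prefix_or_prefix_of_wordMap_eq {V : Set (Euc d)} (hVΩ : V ⊆ Φ.Ω)
    (hV : ∀ j, MapsTo (Φ.φ j) V V)
    (hd : ∀ i j, i ≠ j → Disjoint (Φ.φ i '' V) (Φ.φ j '' V)) (w v : List (Fin m))
    {x y : Euc d} (hx : x ∈ V) (hy : y ∈ V) (h : wordMap Φ.φ w x = wordMap Φ.φ v y) :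
    w <+: v ∨ v <+: w := by
  induction w generalizing v with
  | nil => exact Or.inl (List.nil_prefix)
  | cons i w ih =>
    cases v with
    | nil => exact Or.inr (List.nil_prefix)
    | cons j v =>
      have hx' := wordMap_mapsTo hV w hx
      have hy' := wordMap_mapsTo hV v hy
      by_cases hij : i = j
      · subst hij
        rcases ih v ((Φ.conformal i).injOn (hVΩ hx') (hVΩ hy') h) with h' | h'
        · exact Or.inl ((List.cons_prefix_cons).2 ⟨rfl, h'⟩)
        · exact Or.inr ((List.cons_prefix_cons).2 ⟨rfl, h'⟩)
      · exact ((hd i j hij).le_bot ⟨mem_image_of_mem _ hx', ⟨_, hy', h.symm⟩⟩).elim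

/-- Packing: disjoint sets of volume at least `(r t)^d · vol V` inside a ball of radius `B t`. The
scale `t` cancels, so the bound is uniform over scales. -/
theorem card_le_of_pairwise_disjoint {V : Set (Euc d)} (hVo : IsOpen V) (hVn : V.Nonempty)
    (hVΩ : V ⊆ Φ.Ω) {r B t : ℝ} (hr : 0 < r) (hB : 0 ≤ B) (ht : 0 < t) (x₀ : Euc d)
    (S : Finset (List (Fin m)))
    (hdisj : (S : Set (List (Fin m))).PairwiseDisjoint fun v => wordMap Φ.φ v '' V)
    (hlow : ∀ v ∈ S, ∀ x ∈ V, r * t ≤ Φ.wordDeriv v x)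
    (hball : ∀ v ∈ S, wordMap Φ.φ v '' V ⊆ Metric.closedBall x₀ (B * t)) :
    (S.card : ℝ) ≤ (B / r) ^ d * (volume.real (Metric.closedBall (0 : Euc d) 1) /
      volume.real V) := by
  have hVfin : volume V ≠ ⊤ := (Φ.isBounded.subset hVΩ).measure_lt_top.ne
  have hVpos : 0 < volume.real V := ENNReal.toReal_pos (hVo.measure_pos volume hVn).ne' hVfin
  have himgo : ∀ v, MeasurableSet (wordMap Φ.φ v '' V) := fun v => by
    refine hVo.measurableSet.image_of_continuousOn_injOn (fun x hx => ?_)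
      ((wordMap_injOn Φ.mapsTo (fun j => (Φ.conformal j).injOn) v).mono hVΩ)
    obtain ⟨A, hA, -⟩ := Φ.hasFDerivAt_wordMap v (hVΩ hx)
    exact hA.continuousAt.continuousWithinAt
  have hfinite : ∀ v ∈ S, volume (wordMap Φ.φ v '' V) ≠ ⊤ := fun v hv =>
    (Metric.isBounded_closedBall.subset (hball v hv)).measure_lt_top.ne
  have h1 : ∀ v ∈ S, (r * t) ^ d * volume.real V ≤ volume.real (wordMap Φ.φ v '' V) :=
    fun v hv => by
      have h := Φ.le_volume_image_wordMap v hVo.measurableSet hVΩ (by positivity) (hlow v hv)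
      have h' := ENNReal.toReal_mono (hfinite v hv) h
      rwa [ENNReal.toReal_mul, ENNReal.toReal_ofReal (by positivity)] at h'
  have h2 : (S.card : ℝ) * ((r * t) ^ d * volume.real V) ≤
      (B * t) ^ d * volume.real (Metric.closedBall (0 : Euc d) 1) := by
    calc _ = ∑ v ∈ S, (r * t) ^ d * volume.real V := by rw [Finset.sum_const, nsmul_eq_mul]
      _ ≤ ∑ v ∈ S, volume.real (wordMap Φ.φ v '' V) := Finset.sum_le_sum h1
      _ = volume.real (⋃ v ∈ S, wordMap Φ.φ v '' V) :=
        (measureReal_biUnion_finset hdisj (fun v _ => himgo v) hfinite).symm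
      _ ≤ volume.real (Metric.closedBall x₀ (B * t)) :=
        measureReal_mono (iUnion₂_subset hball) measure_closedBall_lt_top.ne
      _ = _ := by
        rw [measureReal_def, Measure.addHaar_closedBall' _ _ (by positivity), ENNReal.toReal_mul,
          ENNReal.toReal_ofReal (by positivity), finrank_euclideanSpace_fin, measureReal_def]
  rw [mul_pow, mul_pow] at h2
  rw [div_pow, div_mul_div_comm, le_div_iff₀ (by positivity)]
  have htd : 0 < t ^ d := by positivity
  refine le_of_mul_le_mul_right ?_ htd
  linarith

/-- The words `v` such that `φ_v(S)` meets `φ_u(S)` at a point where the dilation factors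
of `φ_v` and `φ_u` are comparable. This is invariant under composition with any `φ_w`. -/
def neighborWords (S : Set (Euc d)) (κ : ℝ) (u : List (Fin m)) : Set (List (Fin m)) :=
  {v | ∃ y ∈ S, ∃ z ∈ S, wordMap Φ.φ v y = wordMap Φ.φ u z ∧
    κ * Φ.wordDeriv u z ≤ Φ.wordDeriv v y ∧ Φ.wordDeriv v y ≤ Φ.wordDeriv u z}

theorem append_mem_neighborWords {S : Set (Euc d)} (hS : S ⊆ Φ.Ω) {κ : ℝ}
    {u v : List (Fin m)} (w : List (Fin m)) (hv : v ∈ Φ.neighborWords S κ u) :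
    w ++ v ∈ Φ.neighborWords S κ (w ++ u) := by
  obtain ⟨y, hy, z, hz, h, h1, h2⟩ := hv
  have hpos := Φ.wordDeriv_pos w (Φ.wordMap_mem u (hS hz))
  refine ⟨y, hy, z, hz, by rw [wordMap_append, wordMap_append, h], ?_, ?_⟩
  · rw [wordDeriv_append, wordDeriv_append, h, mul_left_comm]
    exact mul_le_mul_of_nonneg_left h1 hpos.le
  · rw [wordDeriv_append, wordDeriv_append, h]
    exact mul_le_mul_of_nonneg_left h2 hpos.le

/-- By distortion all neighbours have dilation factors comparable to that of `u`, and their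
cylinders stay near that of `u`, so packing applies to families with disjoint images of `V`.
Overlaps come only from prefixes, and comparability limits how much longer an extension can be. -/
theorem exists_card_neighborWords_le {α : ℝ≥0} (hα : Φ.IsC1Holder α)
    (hosc : Φ.OpenSetCondition) {S : Set (Euc d)} (hS : S ⊆ Φ.Ω) {κ : ℝ} (hκ : 0 < κ) :
    ∃ M : ℕ, ∀ (u : List (Fin m)) (E : Finset (List (Fin m))),
      (E : Set (List (Fin m))) ⊆ Φ.neighborWords S κ u → E.card ≤ M := by
  obtain ⟨V, hVo, hVn, hVΩ, hVφ, hVd⟩ := hosc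
  obtain ⟨A, hA1, hA⟩ := Φ.exists_distortion hα
  obtain ⟨B, hB, hBd⟩ := Φ.exists_dist_wordMap_le hα
  obtain ⟨κ', b, -, hb0, hb1, hb⟩ := Φ.exists_deriv_bounds
  have hA0 : 0 < A := by linarith
  obtain ⟨o, ho⟩ := Φ.isConnected.nonempty
  -- Appending `q` letters shrinks the factor by more than the comparability constants allow. Words
  -- of `E` whose lengths agree modulo `q` are thus never proper prefixes of one another, and each
  -- of the `q` classes has at most `M` elements.
  obtain ⟨q, hq0, hq⟩ : ∃ q : ℕ, 0 < q ∧ A * A * (A * A) * b ^ q < κ := by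
    have h : Tendsto (fun q : ℕ => A * A * (A * A) * b ^ q) atTop (𝓝 (A * A * (A * A) * 0)) :=
      (tendsto_pow_atTop_nhds_zero_of_lt_one hb0.le hb1).const_mul _
    rw [mul_zero] at h
    obtain ⟨q, h1, h2⟩ := ((h.eventually_lt_const hκ).and (eventually_gt_atTop 0)).exists
    exact ⟨q, h2, h1⟩
  set r := κ / (A * A) with hr
  have hr0 : 0 < r := by positivity
  set B' := B * (A * A) + B with hB'
  set M := ⌊(B' / r) ^ d * (volume.real (Metric.closedBall (0 : Euc d) 1) /
      volume.real V)⌋₊ with hM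
  refine ⟨M * q, fun u E hE => ?_⟩
  set t := Φ.wordDeriv u o with ht
  have ht0 : 0 < t := Φ.wordDeriv_pos u ho
  have hlow : ∀ v ∈ E, ∀ x ∈ Φ.Ω, r * t ≤ Φ.wordDeriv v x := fun v hv x hx => by
    obtain ⟨y, hy, z, hz, -, h1, -⟩ := hE hv
    rw [hr, div_mul_eq_mul_div, div_le_iff₀ (by positivity)]
    calc κ * t ≤ κ * (A * Φ.wordDeriv u z) := by gcongr; exact hA _ _ ho _ (hS hz)
      _ = A * (κ * Φ.wordDeriv u z) := by ring
      _ ≤ A * (A * Φ.wordDeriv v x) :=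
        mul_le_mul_of_nonneg_left (h1.trans (hA _ _ (hS hy) _ hx)) hA0.le
      _ = _ := by ring
  have hup : ∀ v ∈ E, ∀ x ∈ Φ.Ω, Φ.wordDeriv v x ≤ A * A * t := fun v hv x hx => by
    obtain ⟨y, hy, z, hz, -, -, h2⟩ := hE hv
    calc Φ.wordDeriv v x ≤ A * Φ.wordDeriv v y := hA _ _ hx _ (hS hy)
      _ ≤ A * (A * t) := by
        gcongr
        exact h2.trans (hA _ _ (hS hz) _ ho)
      _ = _ := by ring
  have hball : ∀ v ∈ E, wordMap Φ.φ v '' V ⊆ Metric.closedBall (wordMap Φ.φ u o) (B' * t) := by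
    rintro v hv _ ⟨x, hx, rfl⟩
    obtain ⟨y, hy, z, hz, h, -, -⟩ := hE hv
    rw [Metric.mem_closedBall]
    calc _ ≤ dist (wordMap Φ.φ v x) (wordMap Φ.φ v y) +
          dist (wordMap Φ.φ u z) (wordMap Φ.φ u o) := by rw [← h]; exact dist_triangle _ _ _
      _ ≤ B * (A * A * t) + B * t := by
        refine add_le_add ((hBd v x (hVΩ hx) y (hS hy) o ho).trans ?_)
          (hBd u z (hS hz) o ho o ho)
        gcongr
        exact hup v hv o ho
      _ = _ := by rw [hB']; ring
  have hlen : ∀ v s, v ∈ E → v ++ s ∈ E → s.length < q := fun v s hv hvs => by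
    by_contra! hs
    have h1 := hlow _ hvs o ho
    rw [wordDeriv_append] at h1
    have h2 : Φ.wordDeriv s o ≤ b ^ q :=
      (Φ.wordDeriv_le_pow_length hb0.le (fun j x hx => (hb j x hx).2) s ho).trans
        (pow_le_pow_of_le_one hb0.le hb1.le hs)
    have h3 : r * t ≤ A * A * t * b ^ q := h1.trans
      (mul_le_mul (hup v hv _ (Φ.wordMap_mem s ho)) h2 (Φ.wordDeriv_nonneg _ _) (by positivity))
    have h4 : r ≤ A * A * b ^ q := le_of_mul_le_mul_right (by linarith) ht0
    rw [hr, div_le_iff₀ (by positivity)] at h4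
    linarith
  have hmod : ∀ v v', v ∈ E → v' ∈ E → v.length % q = v'.length % q → v <+: v' → v = v' := by
    rintro v _ hv hv' hvv' ⟨s, rfl⟩
    have hs := hlen v s hv hv'
    rw [List.length_append] at hvv'
    have h : (v.length + 0) % q = (v.length + s.length) % q := by rwa [add_zero]
    have h0 : 0 % q = s.length % q := Nat.ModEq.add_left_cancel' v.length h
    rw [Nat.zero_mod, Nat.mod_eq_of_lt hs] at h0
    rw [List.length_eq_zero_iff.1 h0.symm, List.append_nil]
  have hcard := Finset.card_le_mul_card_image_of_maps_to (s := E) (t := Finset.range q)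
    (f := fun v => v.length % q) (fun v _ => Finset.mem_range.2 (Nat.mod_lt _ hq0)) M
    fun i _ => by
      refine Nat.le_floor (Φ.card_le_of_pairwise_disjoint hVo hVn hVΩ hr0 (by positivity) ht0
        (wordMap Φ.φ u o) _ ?_ (fun v hv x hx => hlow v (Finset.mem_filter.1 hv).1 x (hVΩ hx))
        fun v hv => hball v (Finset.mem_filter.1 hv).1)
      intro v hv v' hv' hne
      rw [Finset.mem_coe, Finset.mem_filter] at hv hv'
      refine Set.disjoint_left.2 ?_
      rintro _ ⟨x, hx, rfl⟩ ⟨y, hy, hxy⟩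
      rcases Φ.prefix_or_prefix_of_wordMap_eq hVΩ (fun j => mapsTo_iff_image_subset.2 (hVφ j)) hVd
        v v' hx hy hxy.symm with h | h
      · exact hne (hmod v v' hv.1 hv'.1 (hv.2.trans hv'.2.symm) h)
      · exact hne (hmod v' v hv'.1 hv.1 (hv'.2.trans hv.2.symm) h).symm
  rwa [Finset.card_range] at hcard

/-- Letters are removed from the end while the factor of the remaining prefix stays at most `t`.
Removing one letter divides the factor by at least `κ`, so the last admissible prefix is within a
factor `κ` of `t`. -/
theorem exists_prefix_wordDeriv {S : Set (Euc d)} (hS : S ⊆ Φ.Ω) (hSφ : ∀ j, MapsTo (Φ.φ j) S S)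
    {κ : ℝ} (hκ0 : 0 ≤ κ) (hκ1 : κ ≤ 1) (hκ : ∀ j, ∀ x ∈ Φ.Ω, κ ≤ ‖fderiv ℝ (Φ.φ j) x‖) {t : ℝ}
    (ht1 : t ≤ 1) (v : List (Fin m)) {y : Euc d} (hy : y ∈ S) (hv : Φ.wordDeriv v y ≤ t) :
    ∃ v₁ v₂, v = v₁ ++ v₂ ∧ κ * t ≤ Φ.wordDeriv v₁ (wordMap Φ.φ v₂ y) ∧
      Φ.wordDeriv v₁ (wordMap Φ.φ v₂ y) ≤ t := by
  induction v using List.reverseRecOn generalizing y with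
  | nil =>
    refine ⟨[], [], rfl, ?_, hv⟩
    simp only [wordDeriv]
    nlinarith
  | append_singleton v j ih =>
    have e : Φ.wordDeriv (v ++ [j]) y = Φ.wordDeriv v (Φ.φ j y) * ‖fderiv ℝ (Φ.φ j) y‖ := by
      rw [wordDeriv_append]
      simp [wordDeriv, wordMap]
    by_cases h : Φ.wordDeriv v (Φ.φ j y) ≤ t
    · obtain ⟨v₁, v₂, rfl, h1, h2⟩ := ih (hSφ j hy) h
      refine ⟨v₁, v₂ ++ [j], by simp, ?_, ?_⟩ <;> rwa [wordMap_append]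
    · refine ⟨v ++ [j], [], by simp, ?_, hv⟩
      change κ * t ≤ Φ.wordDeriv (v ++ [j]) y
      rw [e, mul_comm]
      exact mul_le_mul (not_le.1 h).le (hκ j y (hS hy)) hκ0 (Φ.wordDeriv_nonneg _ _)

/-- The open set condition provides a word `u` whose occurrence in a coding of a point determines
all the letters that precede it. -/
theorem exists_separating_word {α : ℝ≥0} (hα : Φ.IsC1Holder α) (hosc : Φ.OpenSetCondition)
    {S : Set (Euc d)} (hS : S ⊆ Φ.Ω) (hSφ : S = ⋃ j, Φ.φ j '' S) :
    ∃ u : List (Fin m), ∀ w v : List (Fin m), w.length = v.length → ∀ y ∈ S, ∀ z ∈ S,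
      wordMap Φ.φ (w ++ u) z = wordMap Φ.φ v y → w = v := by
  obtain ⟨κ, b, hκ, hb0, hb1, hb⟩ := Φ.exists_deriv_bounds
  have hκ1 : κ ≤ 1 := by
    obtain ⟨j⟩ := Φ.nonempty_index
    obtain ⟨x, hx⟩ := Φ.isConnected.nonempty
    linarith [(hb j x hx).1, (hb j x hx).2]
  have hSm : ∀ j, MapsTo (Φ.φ j) S S := fun j x hx => by
    rw [hSφ]
    exact mem_iUnion.2 ⟨j, mem_image_of_mem _ hx⟩
  obtain ⟨M, hM⟩ := Φ.exists_card_neighborWords_le hα hosc hS hκ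
  have hfin : ∀ u, (Φ.neighborWords S κ u).Finite := fun u => by
    by_contra hinf
    obtain ⟨E, hE, hcard⟩ := Set.Infinite.exists_subset_card_eq hinf (M + 1)
    have := hM u E hE
    omega
  have hncard : ∀ u, (Φ.neighborWords S κ u).ncard ≤ M := fun u => by
    rw [Set.ncard_eq_toFinset_card _ (hfin u)]
    exact hM u _ (by simp)
  -- The uniform bound on the number of neighbours allows a word with the maximal number. Prepending
  -- `w` injects its neighbours into those of `w ++ u`, so by maximality `w ++ u` has no others.
  obtain ⟨u, hu⟩ : ∃ u, ∀ u', (Φ.neighborWords S κ u').ncard ≤ (Φ.neighborWords S κ u).ncard := by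
    have hb : BddAbove (range fun u => (Φ.neighborWords S κ u).ncard) :=
      ⟨M, by rintro _ ⟨u, rfl⟩; exact hncard u⟩
    obtain ⟨u, hu⟩ := Nat.sSup_mem (range_nonempty _) hb
    exact ⟨u, fun u' => by
      have := le_csSup hb ⟨u', rfl⟩
      rwa [← hu] at this⟩
  refine ⟨u, fun w v hwv y hy z hz h => ?_⟩
  have hmax : Φ.neighborWords S κ (w ++ u) = (w ++ ·) '' Φ.neighborWords S κ u := by
    symm
    refine Set.eq_of_subset_of_ncard_le ?_ ?_ (hfin _)
    · rintro _ ⟨v, hv, rfl⟩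
      exact Φ.append_mem_neighborWords hS w hv
    · rw [Set.ncard_image_of_injective _ (List.append_right_injective w)]
      exact hu _
  set t := Φ.wordDeriv (w ++ u) z with ht
  have ht0 : 0 < t := Φ.wordDeriv_pos _ (hS hz)
  have hle := Φ.wordDeriv_le_pow_length hb0.le fun j x hx => (hb j x hx).2
  have ht1 : t ≤ 1 := (hle _ (hS hz)).trans (pow_le_one₀ hb0.le hb1.le)
  -- The word `v` is extended along a coding of `y` until its factor falls below `t`, then cut at
  -- scale `t`. The resulting prefix is a neighbour of `w ++ u`, hence begins with `w`, as does the
  -- extension of `v`.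
  obtain ⟨n, hn⟩ := exists_pow_lt_of_lt_one ht0 hb1
  obtain ⟨v', hv', y', hy', rfl⟩ := exists_wordMap_eq hSφ.subset n hy
  have hD : Φ.wordDeriv (v ++ v') y' ≤ t := by
    refine (hle _ (hS hy')).trans (le_trans ?_ hn.le)
    refine pow_le_pow_of_le_one hb0.le hb1.le ?_
    rw [List.length_append, hv']
    omega
  obtain ⟨v₁, v₂, hvv, h1, h2⟩ := Φ.exists_prefix_wordDeriv hS hSm hκ.le hκ1
    (fun j x hx => (hb j x hx).1) ht1 _ hy' hD
  have hmem : v₁ ∈ Φ.neighborWords S κ (w ++ u) := by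
    refine ⟨_, wordMap_mapsTo hSm v₂ hy', z, hz, ?_, h1, h2⟩
    rw [h, ← wordMap_append, ← hvv, wordMap_append]
  rw [hmax] at hmem
  obtain ⟨s, -, rfl⟩ := hmem
  simp only [List.append_assoc] at hvv
  exact (List.append_inj_left hvv hwv.symm).symm

end ConformalIFS

/-! ### The coding map, unique codings and the induced map. -/

namespace ConformalIFS

open TopologicalSpace (NonemptyCompacts)

variable {d m : ℕ} {Φ : ConformalIFS d m}

theorem prefixMap_eq_wordMap (I : ℕ → Fin m) (n : ℕ) (x : Euc d) :
    Φ.prefixMap I n x = wordMap Φ.φ ((List.range n).map I) x := by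
  induction n generalizing x with
  | zero => rfl
  | succ n ih =>
    rw [List.range_succ, List.map_append, wordMap_append, ← ih]
    rfl

theorem prefixMap_succ_eq (I : ℕ → Fin m) (n : ℕ) (x : Euc d) :
    Φ.prefixMap I (n + 1) x = Φ.φ (I 0) (Φ.prefixMap (fun k => I (k + 1)) n x) := by
  rw [prefixMap_eq_wordMap, prefixMap_eq_wordMap, List.range_succ_eq_map, List.map_cons,
    List.map_map]
  rfl

namespace IsSelfConformalSet

variable {K : NonemptyCompacts (Euc d)} (hK : Φ.IsSelfConformalSet K)

include hK

theorem mapsTo (j : Fin m) : MapsTo (Φ.φ j) K K := fun x hx => by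
  rw [hK.2]
  exact mem_iUnion.2 ⟨j, mem_image_of_mem _ hx⟩

theorem prefixMap_mem (I : ℕ → Fin m) (n : ℕ) {x : Euc d} (hx : x ∈ K) :
    Φ.prefixMap I n x ∈ K := by
  rw [prefixMap_eq_wordMap]
  exact wordMap_mapsTo hK.mapsTo _ hx

theorem exists_dist_prefixMap_le : ∃ c D : ℝ, 0 < c ∧ c < 1 ∧ ∀ (I : ℕ → Fin m) (n : ℕ),
    ∀ x ∈ K, ∀ y ∈ K, dist (Φ.prefixMap I n x) (Φ.prefixMap I n y) ≤ D * c ^ n := by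
  obtain ⟨c, hc, hc1, hcφ⟩ := Φ.exists_contraction
  refine ⟨c, Metric.diam Φ.Ω, hc, hc1, fun I n x hx y hy => ?_⟩
  rw [prefixMap_eq_wordMap, prefixMap_eq_wordMap, mul_comm]
  refine (Φ.dist_wordMap_le hc.le hcφ _ (hK.1 hx) (hK.1 hy)).trans ?_
  rw [List.length_map, List.length_range]
  exact mul_le_mul_of_nonneg_left (Metric.dist_le_diam_of_mem Φ.isBounded (hK.1 hx) (hK.1 hy))
    (by positivity)

variable {x₀ : Euc d} (hx₀ : x₀ ∈ K)

include hx₀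

theorem tendsto_prefixMap (I : ℕ → Fin m) :
    Tendsto (fun n => Φ.prefixMap I n x₀) atTop (𝓝 (Φ.codingMap x₀ I)) := by
  obtain ⟨c, D, -, hc1, h⟩ := hK.exists_dist_prefixMap_le
  exact (cauchySeq_of_le_geometric c D hc1 fun n =>
    h I n _ hx₀ _ (hK.mapsTo (I n) hx₀)).tendsto_limUnder

theorem codingMap_mem (I : ℕ → Fin m) : Φ.codingMap x₀ I ∈ K :=
  K.isCompact.isClosed.mem_of_tendsto (hK.tendsto_prefixMap hx₀ I)
    (Eventually.of_forall fun n => hK.prefixMap_mem I n hx₀)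

theorem codingMap_eq_of_forall_exists {I : ℕ → Fin m} {x : Euc d}
    (h : ∀ n, ∃ y ∈ K, Φ.prefixMap I n y = x) : Φ.codingMap x₀ I = x := by
  obtain ⟨c, D, hc, hc1, hD⟩ := hK.exists_dist_prefixMap_le
  refine tendsto_nhds_unique (hK.tendsto_prefixMap hx₀ I) (tendsto_iff_dist_tendsto_zero.2 ?_)
  have hlim := (tendsto_pow_atTop_nhds_zero_of_lt_one hc.le hc1).const_mul D
  rw [mul_zero] at hlim
  refine squeeze_zero (fun _ => dist_nonneg) (fun n => ?_) hlim
  obtain ⟨y, hy, rfl⟩ := h n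
  exact hD I n _ hx₀ _ hy

theorem codingMap_eq_apply (I : ℕ → Fin m) :
    Φ.codingMap x₀ I = Φ.φ (I 0) (Φ.codingMap x₀ fun k => I (k + 1)) := by
  have h1 := (hK.tendsto_prefixMap hx₀ I).comp (tendsto_add_atTop_nat 1)
  have hmem := hK.1 (hK.codingMap_mem hx₀ fun k => I (k + 1))
  have hc : ContinuousAt (Φ.φ (I 0)) (Φ.codingMap x₀ fun k => I (k + 1)) :=
    (Φ.conformal (I 0)).contDiffOn.continuousOn.continuousAt (Φ.isOpen.mem_nhds hmem)
  have h2 := hc.tendsto.comp (hK.tendsto_prefixMap hx₀ fun k => I (k + 1))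
  refine tendsto_nhds_unique h1 (h2.congr fun n => ?_)
  exact (prefixMap_succ_eq I n x₀).symm

theorem exists_codingMap_eq {x : Euc d} (hx : x ∈ K) : ∃ I, Φ.codingMap x₀ I = x := by
  have h : ∀ y : K, ∃ (j : Fin m) (z : K), Φ.φ j z = y := fun y => by
    have hy : (y : Euc d) ∈ (K : Set (Euc d)) := y.2
    rw [hK.2] at hy
    obtain ⟨j, z, hz, h⟩ := mem_iUnion.1 hy
    exact ⟨j, ⟨z, hz⟩, h⟩
  choose j s hs using h
  refine ⟨fun n => j (s^[n] ⟨x, hx⟩), hK.codingMap_eq_of_forall_exists hx₀ fun n =>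
    ⟨s^[n] ⟨x, hx⟩, (s^[n] ⟨x, hx⟩).2, ?_⟩⟩
  induction n with
  | zero => rfl
  | succ n ih =>
    rw [Function.iterate_succ_apply']
    change Φ.prefixMap _ n (Φ.φ (j (s^[n] ⟨x, hx⟩)) _) = x
    rw [hs, ih]

theorem codingMap_mem_image (I : ℕ → Fin m) (n : ℕ) :
    Φ.codingMap x₀ I ∈ wordMap Φ.φ ((List.range n).map I) '' K := by
  induction n generalizing I with
  | zero => exact ⟨_, hK.codingMap_mem hx₀ I, rfl⟩
  | succ n ih =>
    obtain ⟨y, hy, h⟩ := ih fun k => I (k + 1)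
    refine ⟨y, hy, ?_⟩
    rw [← prefixMap_eq_wordMap] at h
    rw [hK.codingMap_eq_apply hx₀, ← prefixMap_eq_wordMap, prefixMap_succ_eq, h]

theorem exists_codingMap_eq_of_mem_image (w : List (Fin m)) {x : Euc d}
    (hx : x ∈ wordMap Φ.φ w '' K) :
    ∃ I, (List.range w.length).map I = w ∧ Φ.codingMap x₀ I = x := by
  induction w generalizing x with
  | nil =>
    obtain ⟨y, hy, rfl⟩ := hx
    obtain ⟨I, hI⟩ := hK.exists_codingMap_eq hx₀ hy
    exact ⟨I, rfl, hI⟩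
  | cons j w ih =>
    obtain ⟨y, hy, rfl⟩ := hx
    obtain ⟨I, hI, hIx⟩ := ih (mem_image_of_mem _ hy)
    refine ⟨fun n => Nat.casesOn n j I, ?_, ?_⟩
    · rw [List.length_cons, List.range_succ_eq_map, List.map_cons, List.map_map]
      exact congrArg (j :: ·) hI
    · rw [hK.codingMap_eq_apply hx₀]
      exact congrArg (Φ.φ j) hIx

/-- Distinct codings differ on some finite prefix, and each point of a cylinder has a coding
starting with its word. This exhibits the set as a compact set minus a countable union of compact
overlaps, hence as Borel. -/
theorem uniquelyCoded_eq : Φ.uniquelyCoded K x₀ =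
    (K : Set (Euc d)) \ ⋃ (w : List (Fin m)) (v : List (Fin m)) (_ : w.length = v.length ∧ w ≠ v),
      wordMap Φ.φ w '' K ∩ wordMap Φ.φ v '' K := by
  ext x
  simp only [uniquelyCoded, mem_ofPred_eq, Set.mem_sdiff, SetLike.mem_coe, mem_iUnion, not_exists]
  refine and_congr_right fun hx => ⟨?_, fun h => ?_⟩
  · rintro ⟨I, -, hI⟩ w v ⟨hlen, hne⟩ ⟨hw, hv⟩
    obtain ⟨J, hJ, hJx⟩ := hK.exists_codingMap_eq_of_mem_image hx₀ w hw
    obtain ⟨L, hL, hLx⟩ := hK.exists_codingMap_eq_of_mem_image hx₀ v hv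
    rw [hI J hJx] at hJ
    rw [hI L hLx, ← hlen] at hL
    exact hne (hJ.symm.trans hL)
  · obtain ⟨I, hI⟩ := hK.exists_codingMap_eq hx₀ hx
    refine ⟨I, hI, fun J hJ => ?_⟩
    by_contra hne
    obtain ⟨k, hk⟩ := Function.ne_iff.1 hne
    refine h ((List.range (k + 1)).map I) ((List.range (k + 1)).map J) ⟨by simp, fun he => ?_⟩
      ⟨hI ▸ hK.codingMap_mem_image hx₀ I _, hJ ▸ hK.codingMap_mem_image hx₀ J _⟩
    rw [List.map_inj_left] at he
    exact hk (he k (by simp)).symm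

omit hx₀ in
theorem isCompact_image_wordMap (w : List (Fin m)) : IsCompact (wordMap Φ.φ w '' K) := by
  refine K.isCompact.image_of_continuousOn fun x hx => ?_
  obtain ⟨A, hA, -⟩ := Φ.hasFDerivAt_wordMap w (hK.1 hx)
  exact hA.continuousAt.continuousWithinAt

theorem measurableSet_uniquelyCoded : MeasurableSet (Φ.uniquelyCoded K x₀) := by
  rw [hK.uniquelyCoded_eq hx₀]
  exact K.isCompact.measurableSet.diff <| MeasurableSet.iUnion fun w =>
    MeasurableSet.iUnion fun v => MeasurableSet.iUnion fun _ =>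
      (hK.isCompact_image_wordMap w).measurableSet.inter
        (hK.isCompact_image_wordMap v).measurableSet

/-- Prefixing a coding of `y` by `j` codes `φ_j y`; by uniqueness it is the coding used by `T`, and
the shift removes `j`. -/
theorem inducedMap_apply {j : Fin m} {y : Euc d} (hy : y ∈ K)
    (h : Φ.φ j y ∈ Φ.uniquelyCoded K x₀) : Φ.inducedMap K x₀ (Φ.φ j y) = y := by
  obtain ⟨I, hI⟩ := hK.exists_codingMap_eq hx₀ hy
  have hJ : Φ.codingMap x₀ (fun n => Nat.casesOn n j I) = Φ.φ j y := by
    rw [hK.codingMap_eq_apply hx₀]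
    exact congrArg (Φ.φ j) hI
  have heq := h.2.unique h.2.choose_spec.1 hJ
  rw [inducedMap, dif_pos h, heq]
  exact hI

/-- On the uniquely coded set the preimage of a closed `C` is cut out by the compact sets `φ_j(K ∩
C)`; elsewhere the map is the identity. -/
theorem measurable_inducedMap : Measurable (Φ.inducedMap K x₀) := by
  have hU := hK.measurableSet_uniquelyCoded hx₀
  refine measurable_of_isClosed fun C hC => ?_
  have heq : Φ.inducedMap K x₀ ⁻¹' C = (Φ.uniquelyCoded K x₀ ∩ ⋃ j, Φ.φ j '' (K ∩ C)) ∪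
      ((Φ.uniquelyCoded K x₀)ᶜ ∩ C) := by
    ext x
    by_cases hx : x ∈ Φ.uniquelyCoded K x₀
    · simp only [mem_preimage, mem_union, mem_inter_iff, hx, true_and, mem_compl_iff,
        not_true_eq_false, false_and, or_false, mem_iUnion]
      constructor
      · intro hT
        have hxK : x ∈ (K : Set (Euc d)) := hx.1
        rw [hK.2] at hxK
        obtain ⟨j, y, hy, rfl⟩ := mem_iUnion.1 hxK
        rw [hK.inducedMap_apply hx₀ hy hx] at hT
        exact ⟨j, y, ⟨hy, hT⟩, rfl⟩
      · rintro ⟨j, y, ⟨hy, hyC⟩, rfl⟩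
        rwa [hK.inducedMap_apply hx₀ hy hx]
    · have : Φ.inducedMap K x₀ x = x := dif_neg hx
      simp [hx, this]
  rw [heq]
  refine (hU.inter (MeasurableSet.iUnion fun j => IsCompact.measurableSet ?_)).union
    (hU.compl.inter hC.measurableSet)
  exact (K.isCompact.inter_right hC).image_of_continuousOn
    ((Φ.conformal j).contDiffOn.continuousOn.mono (inter_subset_left.trans hK.1))

/-- An occurrence of the separating word beyond position `k` forces the first `k` letters of every
coding, and such occurrences exist for all `k`. -/
theorem mem_uniquelyCoded_of_separating {u : List (Fin m)}
    (hu : ∀ w v : List (Fin m), w.length = v.length → ∀ y ∈ K, ∀ z ∈ K,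
      wordMap Φ.φ (w ++ u) z = wordMap Φ.φ v y → w = v) {x : Euc d}
    (hx : ∀ k, ∃ w w' : List (Fin m), w.length = k ∧ x ∈ wordMap Φ.φ (w ++ w' ++ u) '' K) :
    x ∈ Φ.uniquelyCoded K x₀ := by
  have hxK : x ∈ K := by
    obtain ⟨w, w', -, y, hy, rfl⟩ := hx 0
    exact wordMap_mapsTo hK.mapsTo _ hy
  have key : ∀ w w' v : List (Fin m), w.length = v.length →
      x ∈ wordMap Φ.φ (w ++ w' ++ u) '' K → x ∈ wordMap Φ.φ v '' K → w = v := by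
    rintro w w' v hlen ⟨z, hz, rfl⟩ ⟨y, hy, h⟩
    -- The word `v` is lengthened to match `w ++ w'`, since the separating property compares words
    -- of equal length.
    obtain ⟨v', hv', y', hy', rfl⟩ := exists_wordMap_eq hK.2.subset w'.length hy
    rw [← wordMap_append] at h
    exact List.append_inj_left (hu _ _ (by simp [hlen, hv']) y' hy' z hz h.symm) hlen
  rw [hK.uniquelyCoded_eq hx₀]
  refine ⟨hxK, ?_⟩
  simp only [mem_iUnion, not_exists]
  rintro v v' ⟨hlen, hne⟩ ⟨hv, hv'⟩
  obtain ⟨w, w', hw, hxw⟩ := hx v.length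
  exact hne ((key w w' v hw hxw hv).symm.trans (key w w' v' (hw.trans hlen) hxw hv'))

end IsSelfConformalSet

end ConformalIFS

/-! ### Log-Hölder regularity of the eigenfunction. -/

section Density

variable {X : Type*} [MetricSpace X] [CompactSpace X]

theorem rpow_le_const_mul_rpow_of_le {t D r β : ℝ} (ht : 0 ≤ t) (htD : t ≤ D) (hβ : 0 < β)
    (hβr : β ≤ r) : t ^ r ≤ D ^ (r - β) * t ^ β := by
  rw [show t ^ r = t ^ (r - β) * t ^ β by
    rw [← Real.rpow_add_of_nonneg ht (sub_nonneg.2 hβr) hβ.le, sub_add_cancel]]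
  exact mul_le_mul_of_nonneg_right (Real.rpow_le_rpow ht htD (sub_nonneg.2 hβr)) (by positivity)

/-- A positive continuous fixed point of a transfer operator with log-Hölder weights is
log-Hölder. -/
theorem le_exp_mul_of_transfer_eq {ι : Type*} [Fintype ι] {a : ι → X → ℝ} {f : ι → X → X}
    {c β C : ℝ} (hc : 0 < c) (hc1 : c < 1) (hβ : 0 < β) (hC : 0 ≤ C) (ha0 : ∀ j x, 0 ≤ a j x)
    (ha : ∀ j x y, a j x ≤ Real.exp (C * dist x y ^ β) * a j y)
    (hf : ∀ j x y, dist (f j x) (f j y) ≤ c * dist x y) {h : X → ℝ} (hh : Continuous h)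
    (hpos : ∀ x, 0 < h x) (hfix : transfer a f h = h) (x y : X) :
    h x ≤ Real.exp (C / (1 - c ^ β) * dist x y ^ β) * h y := by
  set E := Real.exp (C / (1 - c ^ β) * dist x y ^ β) with hE
  have hE0 : 0 < E := Real.exp_pos _
  obtain ⟨x₁, -, hx₁⟩ := isCompact_univ.exists_isMinOn ⟨x, mem_univ x⟩ hh.continuousOn
  have hmin : ∀ z, h x₁ ≤ h z := fun z => isMinOn_iff.1 hx₁ z (mem_univ z)
  refine le_of_forall_pos_le_add fun ε hε => ?_
  -- The comparison of `h` with `(1 + s) * h` costs exactly `ε` at the end. Uniform continuity and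
  -- the positive minimum of `h` give the required inequality at scale `c ^ n`, and both functions
  -- are fixed, so the iterates disappear.
  set s := ε / (E * h y) with hs
  have hs0 : 0 < s := div_pos hε (mul_pos hE0 (hpos y))
  obtain ⟨δ, hδ, hhδ⟩ := Metric.uniformContinuous_iff.1
    (CompactSpace.uniformContinuous_of_continuous hh) (s * h x₁) (mul_pos hs0 (hpos x₁))
  obtain ⟨n, hn⟩ : ∃ n : ℕ, c ^ n * dist x y < δ := by
    have hlim := (tendsto_pow_atTop_nhds_zero_of_lt_one hc.le hc1).mul_const (dist x y)
    rw [zero_mul] at hlim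
    exact (hlim.eventually_lt_const hδ).exists
  have hfix' : transfer a f (fun z => (1 + s) * h z) = fun z => (1 + s) * h z := by
    ext z
    have := congrFun hfix z
    simp only [transfer] at this ⊢
    rw [← this, Finset.mul_sum]
    exact Finset.sum_congr rfl fun j _ => by ring
  have hcomp := transfer_iterate_comparison (f := f) (G := h) (G' := fun z => (1 + s) * h z) hc hc1
    hβ hC ha0 ha hf (fun z => mul_nonneg (by linarith) (hpos z).le) n x y fun x' y' hxy => by
      have h1 := hhδ (hxy.trans_lt hn)
      rw [Real.dist_eq] at h1
      have h2 := mul_le_mul_of_nonneg_left (hmin y') hs0.le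
      linarith [(abs_lt.1 h1).2]
  rw [Function.iterate_fixed hfix, Function.iterate_fixed hfix', ← hE] at hcomp
  calc h x ≤ E * ((1 + s) * h y) := hcomp
    _ = E * h y + s * (E * h y) := by ring
    _ = E * h y + ε := by rw [hs, div_mul_cancel₀ _ (mul_pos hE0 (hpos y)).ne']

end Density

/-! ### Normalization of the Ruelle operator of a Gibbs measure. -/

namespace ConformalIFS

open TopologicalSpace (NonemptyCompacts)

variable {d m : ℕ} {Φ : ConformalIFS d m} {K : NonemptyCompacts (Euc d)}

theorem HolderPotential.ruelle_apply (G : Φ.HolderPotential) (hK : Φ.IsSelfConformalSet K)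
    (f : C(K, ℝ)) (x : K) :
    G.ruelle hK f x = ∑ j, G.weight hK j x * f (selfMap hK j x) := by
  change (∑ j, G.weight hK j * f.comp (selfMap hK j)) x = _
  rw [ContinuousMap.sum_apply]
  rfl

theorem HolderPotential.weight_pos (G : Φ.HolderPotential) (hK : Φ.IsSelfConformalSet K)
    (j : Fin m) (x : K) : 0 < G.weight hK j x :=
  G.pos j _ (mem_image_of_mem _ (hK.1 x.2))

/-- On the compact set `K` each weight has a positive minimum, so Hölder continuity of `g_j` becomes
log-Hölder; composing with the contraction `φ_j` does not increase distances. -/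
theorem HolderPotential.exists_weight_le (G : Φ.HolderPotential) (hK : Φ.IsSelfConformalSet K) :
    ∃ C : ℝ, 0 ≤ C ∧ ∀ j (x y : K),
      G.weight hK j x ≤ Real.exp (C * dist x y ^ (G.exponent : ℝ)) * G.weight hK j y := by
  have := Φ.nonempty_index
  obtain ⟨c, hc, hc1, hcφ⟩ := Φ.exists_contraction
  have key : ∀ j, ∃ C : ℝ, 0 ≤ C ∧ ∀ (x y : K),
      G.weight hK j x ≤ Real.exp (C * dist x y ^ (G.exponent : ℝ)) * G.weight hK j y := by
    intro j
    obtain ⟨H, hH⟩ := G.holder j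
    obtain ⟨x₀, hx₀⟩ := K.nonempty
    obtain ⟨x₁, -, hx₁⟩ := isCompact_univ.exists_isMinOn ⟨(⟨x₀, hx₀⟩ : K), mem_univ _⟩
      (G.weight hK j).continuous.continuousOn
    have hκ := G.weight_pos hK j x₁
    refine ⟨H / G.weight hK j x₁, by positivity, fun x y => ?_⟩
    refine ((hH.mono (image_mono hK.1)).le_exp_mul hκ ?_ (mem_image_of_mem _ x.2)
      (mem_image_of_mem _ y.2)).trans ?_
    · rintro _ ⟨z, hz, rfl⟩
      exact isMinOn_iff.1 hx₁ ⟨z, hz⟩ (mem_univ _)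
    · refine mul_le_mul_of_nonneg_right (Real.exp_le_exp.2 ?_) (G.weight_pos hK j y).le
      refine mul_le_mul_of_nonneg_left (Real.rpow_le_rpow dist_nonneg ?_ G.exponent.2)
        (by positivity)
      refine (hcφ j _ (hK.1 x.2) _ (hK.1 y.2)).trans ?_
      exact mul_le_of_le_one_left dist_nonneg hc1.le
  choose C hC0 hC using key
  obtain ⟨i, hi⟩ := Finite.exists_max C
  refine ⟨C i, hC0 i, fun j x y => (hC j x y).trans ?_⟩
  refine mul_le_mul_of_nonneg_right (Real.exp_le_exp.2 ?_) (G.weight_pos hK j y).le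
  exact mul_le_mul_of_nonneg_right (hi j) (by positivity)

/-- A Gibbs measure is invariant under the dual of a normalized transfer operator with
log-Hölder weights. -/
theorem HolderPotential.IsGibbsMeasure.exists_transferInvariant {G : Φ.HolderPotential}
    {hK : Φ.IsSelfConformalSet K} {μ : Measure (Euc d)} (hG : G.IsGibbsMeasure hK μ) :
    ∃ (μK : Measure K) (p : Fin m → K → ℝ) (C β : ℝ), IsProbabilityMeasure μK ∧
      μ = μK.map Subtype.val ∧ 0 ≤ C ∧ 0 < β ∧ β ≤ 1 ∧ (∀ j, Continuous (p j)) ∧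
      (∀ j x, 0 < p j x) ∧ (∀ x, ∑ j, p j x = 1) ∧
      (∀ j x y, p j x ≤ Real.exp (C * dist x y ^ β) * p j y) ∧
      TransferInvariant μK p fun j => selfMap hK j := by
  obtain ⟨R, h, ν, -, hpos, hfix, hν, hdual, hint, hμ⟩ := hG
  obtain ⟨c, hc, hc1, hcφ⟩ := Φ.exists_contraction
  obtain ⟨C, hC0, hC⟩ := G.exists_weight_le hK
  obtain ⟨x₀, hx₀⟩ := K.nonempty
  have := Φ.nonempty_index
  set f : Fin m → K → K := fun j => selfMap hK j with hf
  have hfc : ∀ j, Continuous (f j) := fun j => (selfMap hK j).continuous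
  have hfix' : ∀ x, ∑ j, G.weight hK j x * h (f j x) = R * h x := fun x => by
    rw [← G.ruelle_apply hK h x, hfix]
    rfl
  have hR : 0 < R := by
    have h1 : 0 < R * h ⟨x₀, hx₀⟩ := by
      rw [← hfix']
      exact Finset.sum_pos (fun j _ => mul_pos (G.weight_pos hK j _) (hpos _))
        Finset.univ_nonempty
    exact pos_of_mul_pos_left h1 (hpos _).le
  set r := NNReal.toReal G.exponent with hr
  have hr0 : 0 < r := G.exponent_pos
  have hfd : ∀ j (x y : K), dist (f j x) (f j y) ≤ c * dist x y := fun j x y =>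
    hcφ j _ (hK.1 x.2) _ (hK.1 y.2)
  set C' := C / (1 - c ^ r) with hC'
  have hC'0 : 0 ≤ C' :=
    div_nonneg hC0 (sub_nonneg.2 (Real.rpow_lt_one hc.le hc1 hr0).le)
  have hh : ∀ x y, h x ≤ Real.exp (C' * dist x y ^ r) * h y := by
    refine le_exp_mul_of_transfer_eq (a := fun j x => G.weight hK j x / R) (f := f) hc hc1 hr0 hC0
      (fun j x => div_nonneg (G.weight_pos hK j x).le hR.le) (fun j x y => ?_) hfd h.continuous
      hpos ?_
    · rw [← mul_div_assoc]
      exact div_le_div_of_nonneg_right (hC j x y) hR.le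
    · ext x
      have := hfix' x
      calc transfer (fun j x => G.weight hK j x / R) f h x
          = (∑ j, G.weight hK j x * h (f j x)) / R := by
            rw [Finset.sum_div]
            exact Finset.sum_congr rfl fun j _ => by ring
        _ = h x := by rw [this]; field_simp
  -- Conjugation by `h` and division by `R`: the eigenvalue equation for `h` makes these weights sum
  -- to 1.
  set p : Fin m → K → ℝ := fun j x => G.weight hK j x * h (f j x) / (R * h x) with hp
  have hp0 : ∀ j x, 0 < p j x := fun j x =>
    div_pos (mul_pos (G.weight_pos hK j x) (hpos _)) (mul_pos hR (hpos x))
  have hpc : ∀ j, Continuous (p j) := fun j =>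
    ((G.weight hK j).continuous.mul (h.continuous.comp (hfc j))).div
      (continuous_const.mul h.continuous) fun x => (mul_pos hR (hpos x)).ne'
  -- The exponent is capped at 1 so that Lipschitz cutoffs with values in `[0, 1]` are `β`-Hölder.
  set β := min r 1 with hβ
  have hβ0 : 0 < β := lt_min hr0 one_pos
  set D := Metric.diam Φ.Ω with hD
  have hd : ∀ x y : K, dist x y ≤ D := fun x y =>
    Metric.dist_le_diam_of_mem Φ.isBounded (hK.1 x.2) (hK.1 y.2)
  -- The three constants come from the weight, from `h ∘ f j` and from `1 / h`.
  have hplog : ∀ j x y, p j x ≤ Real.exp ((C + C' + C') * dist x y ^ r) * p j y := by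
    intro j x y
    have h1 : h (f j x) ≤ Real.exp (C' * dist x y ^ r) * h (f j y) := by
      refine (hh _ (f j y)).trans ?_
      refine mul_le_mul_of_nonneg_right (Real.exp_le_exp.2 ?_) (hpos _).le
      refine mul_le_mul_of_nonneg_left (Real.rpow_le_rpow dist_nonneg ?_ hr0.le) hC'0
      exact (hfd j x y).trans (mul_le_of_le_one_left dist_nonneg hc1.le)
    have h2 := hh y x
    rw [dist_comm y x] at h2
    simp only [hp]
    rw [← mul_div_assoc, div_le_div_iff₀ (mul_pos hR (hpos x)) (mul_pos hR (hpos y))]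
    have e0 : ∀ z, 0 < h z := hpos
    calc G.weight hK j x * h (f j x) * (R * h y)
        ≤ (Real.exp (C * dist x y ^ r) * G.weight hK j y) *
          (Real.exp (C' * dist x y ^ r) * h (f j y)) *
          (R * (Real.exp (C' * dist x y ^ r) * h x)) := by
          have hw := (G.weight_pos hK j y).le
          refine mul_le_mul (mul_le_mul (hC j x y) h1 (e0 _).le (by positivity))
            (mul_le_mul_of_nonneg_left h2 hR.le) (mul_pos hR (e0 _)).le ?_
          have := (e0 (f j y)).le
          positivity
      _ = _ := by
        rw [add_mul, add_mul, Real.exp_add, Real.exp_add]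
        ring
  have hintK : ∀ u : K → ℝ, ∫ x, u x ∂(ν.withDensity fun x => ENNReal.ofReal (h x)) =
      ∫ x, h x * u x ∂ν := fun u => by
    rw [integral_withDensity_eq_integral_toReal_smul h.continuous.measurable.ennreal_ofReal
      (Eventually.of_forall fun _ => ENNReal.ofReal_lt_top)]
    refine integral_congr_ae (Eventually.of_forall fun x => ?_)
    simp [ENNReal.toReal_ofReal (hpos x).le]
  have hhint : Integrable h ν := by
    obtain ⟨B, hB⟩ := isCompact_univ.exists_bound_of_continuousOn h.continuous.continuousOn
    exact integrable_of_measurable_of_abs_le h.continuous.measurable fun x => hB x (mem_univ x)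
  have hprob : IsProbabilityMeasure (ν.withDensity fun x => ENNReal.ofReal (h x)) := by
    constructor
    rw [withDensity_apply _ MeasurableSet.univ, Measure.restrict_univ,
      ← ofReal_integral_eq_lintegral_ofReal hhint (Eventually.of_forall fun x => (hpos x).le), hint,
      ENNReal.ofReal_one]
  refine ⟨_, p, (C + C' + C') * D ^ (r - β), β, hprob, hμ, ?_, hβ0, min_le_right _ _, hpc, hp0,
    fun x => ?_, fun j x y => (hplog j x y).trans ?_,
    transferInvariant_of_continuous hfc hpc (fun j x => (hp0 j x).le) fun u => ?_⟩
  · have : 0 ≤ D := Metric.diam_nonneg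
    positivity
  · rw [hp, ← Finset.sum_div, hfix', div_self (mul_pos hR (hpos x)).ne']
  · refine mul_le_mul_of_nonneg_right (Real.exp_le_exp.2 ?_) (hp0 j y).le
    rw [mul_assoc]
    exact mul_le_mul_of_nonneg_left
      (rpow_le_const_mul_rpow_of_le dist_nonneg (hd x y) hβ0 (min_le_left _ _)) (by positivity)
  · rw [hintK, hintK]
    -- The density `h` cancels the denominator of `p`, which reduces the claim to the eigenmeasure
    -- equation for `ν` tested on `h * u`.
    have h1 : ∀ x, h x * transfer p f u x = R⁻¹ * G.ruelle hK (h * u) x := fun x => by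
      rw [G.ruelle_apply, Finset.mul_sum, transfer, Finset.mul_sum]
      refine Finset.sum_congr rfl fun j _ => ?_
      have := (hpos x).ne'
      simp only [hp, ContinuousMap.mul_apply]
      field_simp
      rfl
    simp only [h1]
    rw [integral_const_mul, hdual, ← mul_assoc, inv_mul_cancel₀ hR.ne', one_mul]
    rfl

end ConformalIFS

/-! ### Correlation estimates relative to the measure of the second set. -/

section Correlation

variable {ι X Y : Type*} [Fintype ι] [MetricSpace X] [MeasurableSpace X] [BorelSpace X]
  [MeasurableSpace Y] {μ : Measure X} {p : ι → X → ℝ} {f : ι → X → X}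

/-- Decay of correlations from a uniform estimate for an approximation `u` of the indicator
function of `E`, where `Z` contains the set on which they differ. -/
theorem TransferInvariant.abs_correlation_le [IsProbabilityMeasure μ]
    (h : TransferInvariant μ p f) (hf : ∀ j, Continuous (f j)) (hpc : ∀ j, Continuous (p j))
    (hp : ∀ j x, 0 ≤ p j x) (hsum : ∀ x, ∑ j, p j x = 1) {T : Y → Y} (hT : Measurable T)
    {e : X → Y} (he : Measurable e) (hTf : ∀ᵐ x ∂μ, ∀ j, T (e (f j x)) = e x) (n : ℕ)
    {u : X → ℝ} (hu : Measurable u) (hu0 : ∀ x, 0 ≤ u x) (hu1 : ∀ x, u x ≤ 1) {E F Z : Set Y}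
    (hE : MeasurableSet E) (hF : MeasurableSet F) (hZ : MeasurableSet Z) {η ζ : ℝ}
    (hη : ∀ x, |(transfer p f)^[n] u x - ∫ y, u y ∂μ| ≤ η)
    (hζ : ∀ x, (transfer p f)^[n] (fun y => Z.indicator 1 (e y)) x ≤ ζ)
    (huE : ∀ᵐ x ∂μ, |E.indicator 1 (e x) - u x| ≤ Z.indicator 1 (e x)) :
    |μ.real (e ⁻¹' (E ∩ T^[n] ⁻¹' F)) - μ.real (e ⁻¹' E) * μ.real (e ⁻¹' F)| ≤
      (η + 2 * ζ) * μ.real (e ⁻¹' F) := by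
  have hb : ∀ (S : Set Y) y, |S.indicator (1 : Y → ℝ) y| ≤ 1 := fun S y => by
    by_cases hy : y ∈ S <;> simp [hy]
  have hnn : ∀ (S : Set Y) y, 0 ≤ S.indicator (1 : Y → ℝ) y := fun S =>
    indicator_nonneg fun _ _ => zero_le_one
  have hm : ∀ {S : Set Y}, MeasurableSet S → Measurable (S.indicator (1 : Y → ℝ)) := fun hS =>
    measurable_one.indicator hS
  have hub : ∀ x, |u x| ≤ 1 := fun x => abs_le.2 ⟨by linarith [hu0 x], hu1 x⟩
  have hint : ∀ {S : Set Y}, MeasurableSet S →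
      ∫ x, S.indicator (1 : Y → ℝ) (e x) ∂μ = μ.real (e ⁻¹' S) := fun hS => by
    rw [← integral_indicator_one (he hS)]
    rfl
  have hTn : Measurable fun x => T^[n] (e x) := (hT.iterate n).comp he
  have hintegrable : ∀ {v w : X → ℝ}, Measurable v → (∀ x, |v x| ≤ 1) → Measurable w →
      (∀ x, |w x| ≤ 1) → Integrable (fun x => v x * w x) μ := fun hv hv1 hw hw1 =>
    integrable_of_measurable_of_abs_le (B := 1) (hv.mul hw) fun x => by
      rw [abs_mul]
      exact mul_le_one₀ (hv1 x) (abs_nonneg _) (hw1 x)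
  have hPm : ∀ {v : X → ℝ}, Measurable v → Measurable ((transfer p f)^[n] v) := fun hv =>
    measurable_transfer_iterate hf hpc n hv
  have hPb : ∀ {v : X → ℝ}, (∀ x, |v x| ≤ 1) → ∀ x, |(transfer p f)^[n] v x| ≤ 1 := fun hv =>
    abs_transfer_iterate_le hp hsum n hv
  set iF : X → ℝ := fun x => F.indicator 1 (e x) with hiF
  set jF : X → ℝ := fun x => F.indicator 1 (T^[n] (e x)) with hjF
  set iE : X → ℝ := fun x => E.indicator 1 (e x) with hiE
  set iZ : X → ℝ := fun x => Z.indicator 1 (e x) with hiZ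
  have hiFm : Measurable iF := (hm hF).comp he
  have hjFm : Measurable jF := (hm hF).comp hTn
  have hiEm : Measurable iE := (hm hE).comp he
  have hiZm : Measurable iZ := (hm hZ).comp he
  have hdual : ∀ {v : X → ℝ}, Measurable v → (∀ x, |v x| ≤ 1) →
      ∫ x, v x * jF x ∂μ = ∫ x, (transfer p f)^[n] v x * iF x ∂μ := fun hv hvb =>
    h.integral_mul_comp_iterate hf hpc hp hsum hT he hTf n hv hvb (hm hF) (hb F)
  have hFint : Integrable iF μ := integrable_of_measurable_of_abs_le hiFm fun x => hb F _
  have e1 : ∫ x, iE x * jF x ∂μ = μ.real (e ⁻¹' (E ∩ T^[n] ⁻¹' F)) := by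
    rw [← hint (hE.inter (hT.iterate n hF))]
    refine integral_congr_ae (Eventually.of_forall fun x => ?_)
    by_cases h1 : e x ∈ E <;> by_cases h2 : T^[n] (e x) ∈ F <;> simp [hiE, hjF, h1, h2]
  -- Duality is applied to the error indicator as well: the pointwise bound on its iterate extracts
  -- the factor `μ(F)`, which the measure of `Z` alone would not give.
  have k1 : |∫ x, iE x * jF x ∂μ - ∫ x, u x * jF x ∂μ| ≤ ζ * μ.real (e ⁻¹' F) := by
    rw [← integral_sub (hintegrable hiEm (fun x => hb E _) hjFm fun x => hb F _)
      (hintegrable hu hub hjFm fun x => hb F _)]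
    calc _ ≤ ∫ x, |iE x * jF x - u x * jF x| ∂μ := abs_integral_le_integral_abs
      _ ≤ ∫ x, iZ x * jF x ∂μ := by
        refine integral_mono_ae ((hintegrable hiEm (fun x => hb E _) hjFm fun x => hb F _).sub
          (hintegrable hu hub hjFm fun x => hb F _)).abs
          (hintegrable hiZm (fun x => hb Z _) hjFm fun x => hb F _) ?_
        filter_upwards [huE] with x hx
        rw [← sub_mul, abs_mul, abs_of_nonneg (hnn F (T^[n] (e x)))]
        exact mul_le_mul_of_nonneg_right hx (hnn F _)
      _ = ∫ x, (transfer p f)^[n] iZ x * iF x ∂μ := hdual hiZm fun x => hb Z _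
      _ ≤ ∫ x, ζ * iF x ∂μ := integral_mono
        (hintegrable (hPm hiZm) (hPb fun x => hb Z _) hiFm fun x => hb F _) (hFint.const_mul ζ)
        fun x => mul_le_mul_of_nonneg_right (hζ x) (hnn F _)
      _ = _ := by rw [integral_const_mul, hint hF]
  have k2 : |∫ x, u x * jF x ∂μ - (∫ x, u x ∂μ) * μ.real (e ⁻¹' F)| ≤ η * μ.real (e ⁻¹' F) := by
    rw [hdual hu hub, ← hint hF, ← integral_const_mul, ← integral_sub
      (hintegrable (hPm hu) (hPb hub) hiFm fun x => hb F _) (hFint.const_mul _)]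
    calc _ ≤ ∫ x, |(transfer p f)^[n] u x * iF x - (∫ y, u y ∂μ) * iF x| ∂μ :=
        abs_integral_le_integral_abs
      _ ≤ ∫ x, η * iF x ∂μ := by
        refine integral_mono ((hintegrable (hPm hu) (hPb hub) hiFm fun x => hb F _).sub
          (hFint.const_mul _)).abs (hFint.const_mul η) fun x => ?_
        change |(transfer p f)^[n] u x * iF x - (∫ y, u y ∂μ) * iF x| ≤ η * iF x
        rw [← sub_mul, abs_mul, abs_of_nonneg (hnn F (e x))]
        exact mul_le_mul_of_nonneg_right (hη x) (hnn F _)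
      _ = _ := integral_const_mul _ _
  have k3 : |μ.real (e ⁻¹' E) - ∫ x, u x ∂μ| ≤ ζ := by
    have hEint : Integrable iE μ := integrable_of_measurable_of_abs_le hiEm fun x => hb E _
    have huint : Integrable u μ := integrable_of_measurable_of_abs_le hu hub
    have hZint : Integrable iZ μ := integrable_of_measurable_of_abs_le hiZm fun x => hb Z _
    rw [← hint hE, ← integral_sub hEint huint]
    calc _ ≤ ∫ x, |iE x - u x| ∂μ := abs_integral_le_integral_abs
      _ ≤ ∫ x, iZ x ∂μ := integral_mono_ae (hEint.sub huint).abs hZint huE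
      _ = ∫ x, (transfer p f)^[n] iZ x ∂μ :=
        (h.iterate hf hpc hp hsum n hiZm fun x => hb Z _).symm
      _ ≤ ∫ _, ζ ∂μ := integral_mono (integrable_of_measurable_of_abs_le (hPm hiZm)
        (hPb fun x => hb Z _)) (integrable_const ζ) hζ
      _ = ζ := by simp
  have k4 := mul_le_mul_of_nonneg_right k3 (measureReal_nonneg (μ := μ) (s := e ⁻¹' F))
  rw [← abs_of_nonneg (measureReal_nonneg (μ := μ) (s := e ⁻¹' F)), ← abs_mul, sub_mul,
    abs_of_nonneg (measureReal_nonneg (μ := μ) (s := e ⁻¹' F))] at k4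
  rw [e1] at k1
  rw [abs_le] at k1 k2 k4 ⊢
  constructor <;> linarith [k1.1, k1.2, k2.1, k2.2, k4.1, k4.2]

/-- Since `S'` absorbs displacements of size `c ^ n * D`, distortion bounds `Pⁿ 1_S` at `x` by a
constant times `Pⁿ 1_S'` at every `y`. Averaging over `y` and invariance give the measure of `S'`.
-/
theorem transfer_iterate_indicator_le [IsProbabilityMeasure μ] {c β C D : ℝ}
    (hc : 0 < c) (hc1 : c < 1) (hβ : 0 < β) (hC : 0 ≤ C)
    (h : TransferInvariant μ p f) (hf : ∀ j, Continuous (f j)) (hpc : ∀ j, Continuous (p j))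
    (hp : ∀ j x, 0 ≤ p j x) (hsum : ∀ x, ∑ j, p j x = 1)
    (ha : ∀ j x y, p j x ≤ Real.exp (C * dist x y ^ β) * p j y)
    (hfd : ∀ j x y, dist (f j x) (f j y) ≤ c * dist x y) (hD : ∀ x y : X, dist x y ≤ D) (n : ℕ)
    {S S' : Set X} (hS' : MeasurableSet S')
    (hSS' : ∀ x y, dist x y ≤ c ^ n * D → x ∈ S → y ∈ S') (x : X) :
    (transfer p f)^[n] (S.indicator 1) x ≤
      Real.exp (C / (1 - c ^ β) * D ^ β) * μ.real S' := by
  have h1 : 0 < 1 - c ^ β := sub_pos.2 (Real.rpow_lt_one hc.le hc1 hβ)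
  have hnn : ∀ (S : Set X) y, 0 ≤ S.indicator (1 : X → ℝ) y := fun S =>
    indicator_nonneg fun _ _ => zero_le_one
  have hb : ∀ x, |S'.indicator (1 : X → ℝ) x| ≤ 1 := fun x => by
    by_cases hx : x ∈ S' <;> simp [hx]
  have hm : Measurable (S'.indicator (1 : X → ℝ)) := measurable_one.indicator hS'
  have hle : ∀ y, (transfer p f)^[n] (S.indicator 1) x ≤
      Real.exp (C / (1 - c ^ β) * D ^ β) * (transfer p f)^[n] (S'.indicator 1) y := fun y => by
    refine (transfer_iterate_comparison (G' := S'.indicator 1) hc hc1 hβ hC hp ha hfd (hnn S') n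
      x y fun x' y' hxy => ?_).trans ?_
    · by_cases hx : x' ∈ S
      · have := hSS' x' y' (hxy.trans (mul_le_mul_of_nonneg_left (hD x y) (by positivity))) hx
        simp [hx, this]
      · rw [indicator_of_notMem hx]
        exact hnn S' y'
    · refine mul_le_mul_of_nonneg_right (Real.exp_le_exp.2 ?_)
        (transfer_iterate_nonneg hp n (hnn S') y)
      exact mul_le_mul_of_nonneg_left (Real.rpow_le_rpow dist_nonneg (hD x y) hβ.le)
        (by positivity)
  calc _ = ∫ _, (transfer p f)^[n] (S.indicator 1) x ∂μ := by simp
    _ ≤ ∫ y, Real.exp (C / (1 - c ^ β) * D ^ β) * (transfer p f)^[n] (S'.indicator 1) y ∂μ :=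
      integral_mono (integrable_const _) ((integrable_of_measurable_of_abs_le
        (measurable_transfer_iterate hf hpc n hm)
        (abs_transfer_iterate_le hp hsum n hb)).const_mul _) hle
    _ = _ := by
      rw [integral_const_mul, h.iterate hf hpc hp hsum n hm hb, integral_indicator_one hS']

end Correlation

/-- The segment from `x` to a nearby point of `E` is connected, so it meets the frontier, at a point
no farther from `x` than its endpoint in `E`. -/
theorem mem_thickening_frontier {V : Type*} [NormedAddCommGroup V] [NormedSpace ℝ V] {E : Set V}
    {ρ : ℝ} {x : V} (hx : x ∈ Metric.thickening ρ E) (hxE : x ∉ E) :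
    x ∈ Metric.thickening ρ (frontier E) := by
  obtain ⟨y, hy, hxy⟩ := Metric.mem_thickening_iff.1 hx
  obtain ⟨z, hz, hzE⟩ : ∃ z ∈ segment ℝ x y, z ∈ frontier E := by
    by_contra! hno
    have hcases : ∀ z ∈ segment ℝ x y, z ∈ interior E ∨ z ∈ interior Eᶜ := fun z hz => by
      by_contra! hn
      refine hno z hz ⟨?_, hn.1⟩
      by_contra hcl
      exact hn.2 (by rwa [interior_compl])
    have hxs := left_mem_segment ℝ x y
    have hys := right_mem_segment ℝ x y
    obtain ⟨z, -, hz1, hz2⟩ := (convex_segment (𝕜 := ℝ) x y).isPreconnected _ _ isOpen_interior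
      isOpen_interior hcases
      ⟨y, hys, (hcases y hys).resolve_right fun h => interior_subset h hy⟩
      ⟨x, hxs, (hcases x hxs).resolve_left fun h => hxE (interior_subset h)⟩
    exact interior_subset hz2 (interior_subset hz1)
  refine Metric.mem_thickening_iff.2 ⟨z, hzE, ?_⟩
  have := dist_add_dist_of_mem_segment hz
  linarith [dist_nonneg (x := z) (y := y)]

/-! ### Almost everywhere inversion of the branches and invariance of the measure. -/

namespace ConformalIFS

open TopologicalSpace (NonemptyCompacts)

variable {d m : ℕ} {Φ : ConformalIFS d m} {K : NonemptyCompacts (Euc d)}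

theorem coe_wordMap_selfMap (hK : Φ.IsSelfConformalSet K) (w : List (Fin m)) (x : K) :
    ((wordMap (fun j => selfMap hK j) w x : K) : Euc d) = wordMap Φ.φ w x := by
  induction w with
  | nil => rfl
  | cons j w ih => exact congrArg (Φ.φ j) ih

/-- Almost every point has codings in which the separating word occurs arbitrarily late, hence is
uniquely coded. Positivity of the weights transfers this to its images under all branches, where the
induced map undoes the branch. -/
theorem ae_inducedMap_selfMap {α : ℝ≥0} (hα : Φ.IsC1Holder α) (hosc : Φ.OpenSetCondition)
    (hK : Φ.IsSelfConformalSet K) {x₀ : Euc d} (hx₀ : x₀ ∈ K) {μ : Measure K}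
    [IsProbabilityMeasure μ] {p : Fin m → K → ℝ} (hpc : ∀ j, Continuous (p j))
    (hp : ∀ j x, 0 < p j x) (hsum : ∀ x, ∑ j, p j x = 1)
    (h : TransferInvariant μ p fun j => selfMap hK j) :
    ∀ᵐ x ∂μ, ∀ j, Φ.inducedMap K x₀ (selfMap hK j x) = x := by
  have := Φ.nonempty_index
  have hfc : ∀ j, Continuous (selfMap hK j) := fun j => (selfMap hK j).continuous
  obtain ⟨u, hu⟩ := Φ.exists_separating_word hα hosc hK.1 hK.2
  obtain ⟨ε, hε, hpε⟩ : ∃ ε > 0, ∀ j x, ε ≤ p j x := by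
    have hmin : ∀ j, ∃ x, ∀ y, p j x ≤ p j y := fun j => by
      obtain ⟨x, -, hx⟩ := isCompact_univ.exists_isMinOn ⟨(⟨x₀, hx₀⟩ : K), mem_univ _⟩
        (hpc j).continuousOn
      exact ⟨x, fun y => isMinOn_iff.1 hx y (mem_univ y)⟩
    choose z hz using hmin
    obtain ⟨i, hi⟩ := Finite.exists_min fun j => p j (z j)
    exact ⟨p i (z i), hp i _, fun j x => (hi j).trans (hz j x)⟩
  have hae : ∀ᵐ x : K ∂μ, (x : Euc d) ∈ Φ.uniquelyCoded K x₀ := by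
    filter_upwards [h.ae_exists_mem_range_wordMap hfc hpc hε hpε hsum u] with x hx
    refine hK.mem_uniquelyCoded_of_separating hx₀ hu fun k => ?_
    obtain ⟨w, w', hw, y, rfl⟩ := hx k
    exact ⟨w, w', hw, y, y.2, (coe_wordMap_selfMap hK _ y).symm⟩
  filter_upwards [h.ae_comp hfc hpc hp hsum hae] with x hx j
  exact hK.inducedMap_apply hx₀ x.2 (hx j)

/-- This is the duality relation for one step and the constant function 1, which the normalized
operator fixes. -/
theorem measurePreserving_of_transferInvariant (hK : Φ.IsSelfConformalSet K) {μ : Measure K}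
    [IsProbabilityMeasure μ] {p : Fin m → K → ℝ} (hpc : ∀ j, Continuous (p j))
    (hp : ∀ j x, 0 < p j x) (hsum : ∀ x, ∑ j, p j x = 1)
    (h : TransferInvariant μ p fun j => selfMap hK j) {T : Euc d → Euc d} (hT : Measurable T)
    (hTf : ∀ᵐ x ∂μ, ∀ j, T (selfMap hK j x) = x) :
    MeasurePreserving T (μ.map Subtype.val) (μ.map Subtype.val) := by
  refine ⟨hT, Measure.ext fun F hF => ?_⟩
  have hval : Measurable (Subtype.val : K → Euc d) := measurable_subtype_coe
  rw [Measure.map_apply hT hF, Measure.map_apply hval (hT hF), Measure.map_apply hval hF,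
    ← measureReal_eq_measureReal_iff]
  have hdual := h.integral_mul_comp_iterate (fun j => (selfMap hK j).continuous) hpc
    (fun j x => (hp j x).le) hsum hT hval hTf 1 (u := fun _ => 1) measurable_const (B := 1)
    (by simp) (G := F.indicator 1) (measurable_one.indicator hF) (B' := 1) fun y => by
      by_cases hy : y ∈ F <;> simp [hy]
  simp only [transfer_iterate_const hsum, one_mul] at hdual
  rw [← integral_indicator_one (hval (hT hF)), ← integral_indicator_one (hval hF)]
  exact hdual

end ConformalIFS

/-- At distances below 1 the Lipschitz constant `1 / ρ` suffices because `dist ≤ dist ^ β`; beyond,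
the difference is at most 1, and so at most `1 / ρ`. -/
theorem thickenedIndicator_sub_le {X : Type*} [MetricSpace X] {β ρ : ℝ} (hβ : 0 < β) (hβ1 : β ≤ 1)
    (hρ : 0 < ρ) (hρ1 : ρ ≤ 1) (E : Set X) (x y : X) :
    (thickenedIndicator hρ E x : ℝ) - thickenedIndicator hρ E y ≤ ρ⁻¹ * dist x y ^ β := by
  have hρ1' : 1 ≤ ρ⁻¹ := (one_le_inv₀ hρ).2 hρ1
  have h1 : (thickenedIndicator hρ E x : ℝ) ≤ 1 := by
    exact_mod_cast thickenedIndicator_le_one hρ E x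
  have h0 : (0 : ℝ) ≤ thickenedIndicator hρ E y := NNReal.coe_nonneg _
  rcases le_total (dist x y) 1 with hd | hd
  · have hl := (lipschitzWith_thickenedIndicator hρ E).dist_le_mul x y
    rw [NNReal.dist_eq, NNReal.coe_inv, Real.coe_toNNReal _ hρ.le] at hl
    refine (le_abs_self _).trans (hl.trans (mul_le_mul_of_nonneg_left ?_ (by positivity)))
    simpa using Real.rpow_le_rpow_of_exponent_ge' dist_nonneg hd hβ.le hβ1
  · have h2 : 1 ≤ dist x y ^ β := Real.one_le_rpow hd hβ.le
    nlinarith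

/-! ### Exponential mixing: the choice of scale. -/

theorem mainTheorem3 {d m : ℕ} (hd : 1 ≤ d) (Φ : ConformalIFS d m)
    (K : TopologicalSpace.NonemptyCompacts (Euc d)) (μ : Measure (Euc d)) (T : Euc d → Euc d)
    (hsys : Φ.IsSelfConformalSystem K μ T)
    (𝒞 : Set (Set (Euc d))) (hmeas : ∀ E ∈ 𝒞, NullMeasurableSet E μ)
    (hbdry : ∃ C δ : ℝ, 0 < C ∧ 0 < δ ∧ ∀ ρ : ℝ, 0 < ρ → ∀ E ∈ 𝒞,
      μ (Metric.thickening ρ (frontier E)) ≤ ENNReal.ofReal (C * ρ ^ δ)) :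
    IsExponentiallyMixing μ T 𝒞 := by
  obtain ⟨⟨α, hα⟩, hosc, hK, ⟨G, hG⟩, x₀, hx₀, rfl⟩ := hsys
  obtain ⟨μK, p, C, β, hprob, rfl, hC, hβ, hβ1, hpc, hp, hsum, ha, hinv⟩ :=
    hG.exists_transferInvariant
  obtain ⟨c, hc, hc1, hcφ⟩ := Φ.exists_contraction
  obtain ⟨C₀, δ, hC₀, hδ, hbd⟩ := hbdry
  set f : Fin m → K → K := fun j => ConformalIFS.selfMap hK j with hf
  have hfc : ∀ j, Continuous (f j) := fun j => (ConformalIFS.selfMap hK j).continuous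
  have hfd : ∀ j (x y : K), dist (f j x) (f j y) ≤ c * dist x y := fun j x y =>
    hcφ j _ (hK.1 x.2) _ (hK.1 y.2)
  set D := Metric.diam Φ.Ω with hD
  have hD0 : 0 ≤ D := Metric.diam_nonneg
  have hdD : ∀ x y : K, dist x y ≤ D := fun x y =>
    Metric.dist_le_diam_of_mem Φ.isBounded (hK.1 x.2) (hK.1 y.2)
  have hp0 : ∀ j x, 0 ≤ p j x := fun j x => (hp j x).le
  have hval : Measurable (Subtype.val : K → Euc d) := measurable_subtype_coe
  have hT := hK.measurable_inducedMap hx₀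
  have hTf := ConformalIFS.ae_inducedMap_selfMap hα hosc hK hx₀ hpc hp hsum hinv
  have hpres := ConformalIFS.measurePreserving_of_transferInvariant hK hpc hp hsum hinv hT hTf
  set μ := μK.map (Subtype.val : K → Euc d) with hμ
  set T := Φ.inducedMap K x₀ with hTdef
  have hμprob : IsProbabilityMeasure μ := Measure.isProbabilityMeasure_map hval.aemeasurable
  refine ⟨hμprob, hpres, ?_⟩
  obtain ⟨B, γ₀, hB, hγ₀, hγ₀1, hdecay⟩ :=
    exists_transfer_iterate_osc_decay hc hc1 hβ hC hp0 hsum ha hfd hdD hD0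
  set A := Real.exp (C / (1 - c ^ β) * D ^ β) with hA
  have hA0 : 0 < A := Real.exp_pos _
  have hs0 : 0 < √γ₀ := Real.sqrt_pos.2 hγ₀
  have hs1 : √γ₀ < 1 := by rw [Real.sqrt_lt' one_pos]; simpa using hγ₀1
  -- The scale `ρ = σ ^ n` must not shrink faster than `c ^ n`, so that branch displacements stay of
  -- order `ρ`, nor faster than `√γ₀ ^ n`, so that `γ₀ ^ n / ρ ≤ √γ₀ ^ n`.
  set σ := max c √γ₀ with hσ
  have hσ0 : 0 < σ := hc.trans_le (le_max_left _ _)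
  have hσ1 : σ < 1 := max_lt hc1 hs1
  have hσδ : σ ^ δ < 1 := Real.rpow_lt_one hσ0.le hσ1 hδ
  set γ := max (σ ^ δ) √γ₀ with hγ
  have hγ0 : 0 < γ := hs0.trans_le (le_max_right _ _)
  set C₁ := 2 * (A * (C₀ * (1 + D) ^ δ)) with hC₁
  have hC₁0 : 0 < C₁ := by positivity
  refine ⟨γ, hγ0, max_lt hσδ hs1, B + C₁, by positivity, fun n _ => ?_⟩
  set ρ := σ ^ n with hρ
  have hρ0 : 0 < ρ := by positivity
  have hρ1 : ρ ≤ 1 := pow_le_one₀ hσ0.le hσ1.le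
  refine iSup₂_le fun E hE => iSup₂_le fun F hF => iSup_le fun hF0 => ENNReal.ofReal_le_ofReal ?_
  -- Measurable representatives serve in the integrals only; cutoffs and neighbourhoods use `E`
  -- itself, whose frontier may change under null modifications.
  obtain ⟨E', hE'm, hEE'⟩ := hmeas E hE
  obtain ⟨F', hF'm, hFF'⟩ := hF
  have hμF : 0 < μ.real F := ENNReal.toReal_pos hF0.ne' (measure_ne_top _ _)
  have e1 : μ.real F = μK.real (Subtype.val ⁻¹' F') := by
    rw [measureReal_congr hFF', hμ, map_measureReal_apply hval hF'm]
  have e2 : μ.real E = μK.real (Subtype.val ⁻¹' E') := by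
    rw [measureReal_congr hEE', hμ, map_measureReal_apply hval hE'm]
  have e3 : μ.real (E ∩ T^[n] ⁻¹' F) = μK.real (Subtype.val ⁻¹' (E' ∩ T^[n] ⁻¹' F')) := by
    rw [measureReal_congr (hEE'.inter ((hpres.iterate n).quasiMeasurePreserving.preimage_ae_eq
      hFF')), hμ, map_measureReal_apply hval (hE'm.inter (hT.iterate n hF'm))]
  set Z := Metric.thickening ρ (frontier E) with hZ
  set Z' := Metric.thickening ((1 + D) * ρ) (frontier E) with hZ'
  have hZ'm : μK.real (Subtype.val ⁻¹' Z') ≤ C₀ * ((1 + D) * ρ) ^ δ := by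
    rw [← map_measureReal_apply hval Metric.isOpen_thickening.measurableSet, ← hμ]
    exact ENNReal.toReal_le_of_le_ofReal (by positivity) (hbd _ (by positivity) E hE)
  set u : K → ℝ := fun x => thickenedIndicator hρ0 E (x : Euc d) with hu
  have hu1 : ∀ x, u x ≤ 1 := fun x => by
    exact_mod_cast thickenedIndicator_le_one hρ0 E (x : Euc d)
  have hu0 : ∀ x, 0 ≤ u x := fun x => NNReal.coe_nonneg _
  have hum : Measurable u :=
    (NNReal.continuous_coe.comp ((thickenedIndicator hρ0 E).continuous.comp
      continuous_subtype_val)).measurable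
  have hub : ∀ x, |u x| ≤ 1 := fun x => abs_le.2 ⟨by linarith [hu0 x], hu1 x⟩
  -- Invariance makes the integral of `u` the mean of `Pⁿu`, so the deviation is bounded by the
  -- oscillation.
  have hη : ∀ x, |(transfer p f)^[n] u x - ∫ y, u y ∂μK| ≤ B * √γ₀ ^ n := fun x => by
    have hosc' : ∀ x y, (transfer p f)^[n] u x - (transfer p f)^[n] u y ≤ B * √γ₀ ^ n :=
      fun x y => by
        refine (hdecay u ρ⁻¹ ((one_le_inv₀ hρ0).2 hρ1) (fun x y => by linarith [hu1 x, hu0 y])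
          (fun x y => thickenedIndicator_sub_le hβ hβ1 hρ0 hρ1 E _ _) n x y).trans ?_
        rw [mul_assoc]
        refine mul_le_mul_of_nonneg_left ?_ hB.le
        rw [inv_mul_le_iff₀ hρ0, hρ]
        calc γ₀ ^ n = √γ₀ ^ n * √γ₀ ^ n := by rw [← mul_pow, Real.mul_self_sqrt hγ₀.le]
          _ ≤ _ := by
            gcongr
            exact le_max_right _ _
    rw [← hinv.iterate hfc hpc hp0 hsum n hum hub]
    have hint : Integrable ((transfer p f)^[n] u) μK :=
      integrable_of_measurable_of_abs_le (measurable_transfer_iterate hfc hpc n hum)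
        (abs_transfer_iterate_le hp0 hsum n hub)
    have k1 : ∫ y, (transfer p f)^[n] u y ∂μK ≤ (transfer p f)^[n] u x + B * √γ₀ ^ n := by
      have := integral_mono hint (integrable_const ((transfer p f)^[n] u x + B * √γ₀ ^ n))
        fun y => by linarith [hosc' y x]
      simpa using this
    have k2 : (transfer p f)^[n] u x - B * √γ₀ ^ n ≤ ∫ y, (transfer p f)^[n] u y ∂μK := by
      have := integral_mono (integrable_const ((transfer p f)^[n] u x - B * √γ₀ ^ n)) hint
        fun y => by linarith [hosc' x y]
      simpa using this
    exact abs_le.2 ⟨by linarith, by linarith⟩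
  have hζ : ∀ x, (transfer p f)^[n] (fun y => Z.indicator 1 (y : Euc d)) x ≤
      A * μK.real (Subtype.val ⁻¹' Z') := by
    refine transfer_iterate_indicator_le (S := Subtype.val ⁻¹' Z) hc hc1 hβ hC hinv hfc hpc hp0
      hsum ha hfd hdD n (hval Metric.isOpen_thickening.measurableSet) fun x y hxy hx => ?_
    obtain ⟨z, hz, hxz⟩ := Metric.mem_thickening_iff.1 hx
    refine Metric.mem_thickening_iff.2 ⟨z, hz, ?_⟩
    have hcσ : c ^ n ≤ ρ := pow_le_pow_left₀ hc.le (le_max_left _ _) n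
    calc dist (y : Euc d) z ≤ dist (x : Euc d) y + dist (x : Euc d) z := dist_triangle_left _ _ _
      _ < ρ * D + ρ := add_lt_add_of_le_of_lt (hxy.trans (by gcongr)) hxz
      _ = (1 + D) * ρ := by ring
  -- The cutoff is 1 on `E` and 0 outside its `ρ`-neighbourhood; a point between the two is within
  -- `ρ` of the frontier.
  have huE : ∀ᵐ x : K ∂μK, |E'.indicator 1 (x : Euc d) - u x| ≤ Z.indicator 1 (x : Euc d) := by
    filter_upwards [ae_of_ae_map hval.aemeasurable hEE'.mem_iff] with x hx
    by_cases hxE : (x : Euc d) ∈ E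
    · have : u x = 1 := by
        simp only [hu, thickenedIndicator_one hρ0 E hxE, NNReal.coe_one]
      rw [indicator_of_mem (hx.1 hxE), this, Pi.one_apply, sub_self, abs_zero]
      exact indicator_nonneg (fun _ _ => zero_le_one) _
    · rw [indicator_of_notMem (mt hx.2 hxE), zero_sub, abs_neg, abs_of_nonneg (hu0 x)]
      by_cases hxt : (x : Euc d) ∈ Metric.thickening ρ E
      · rw [indicator_of_mem (mem_thickening_frontier hxt hxE)]
        exact hu1 x
      · have : u x = 0 := by
          simp only [hu, thickenedIndicator_zero hρ0 E hxt, NNReal.coe_zero]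
        rw [this]
        exact indicator_nonneg (fun _ _ => zero_le_one) _
  have hmain := hinv.abs_correlation_le hfc hpc hp0 hsum hT hval hTf n hum hu0 hu1 hE'm hF'm
    Metric.isOpen_thickening.measurableSet hη hζ huE
  rw [← e1, ← e2, ← e3] at hmain
  have hdiv : μ.real (E ∩ T^[n] ⁻¹' F) / μ.real F - μ.real E =
      (μ.real (E ∩ T^[n] ⁻¹' F) - μ.real E * μ.real F) / μ.real F := by
    field_simp
  rw [hdiv, abs_div, abs_of_pos hμF, div_le_iff₀ hμF]
  refine hmain.trans (mul_le_mul_of_nonneg_right ?_ hμF.le)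
  have hρδ : ρ ^ δ = (σ ^ δ) ^ n := by
    rw [hρ, ← Real.rpow_natCast, ← Real.rpow_natCast, ← Real.rpow_mul hσ0.le,
      ← Real.rpow_mul hσ0.le, mul_comm]
  have k1 : √γ₀ ^ n ≤ γ ^ n := pow_le_pow_left₀ hs0.le (le_max_right _ _) n
  have k2 : (σ ^ δ) ^ n ≤ γ ^ n := pow_le_pow_left₀ (by positivity) (le_max_left _ _) n
  calc B * √γ₀ ^ n + 2 * (A * μK.real (Subtype.val ⁻¹' Z'))
      ≤ B * √γ₀ ^ n + 2 * (A * (C₀ * ((1 + D) * ρ) ^ δ)) := by gcongr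
    _ = B * √γ₀ ^ n + C₁ * (σ ^ δ) ^ n := by
      rw [Real.mul_rpow (by positivity) hρ0.le, hρδ, hC₁]
      ring
    _ ≤ B * γ ^ n + C₁ * γ ^ n := by gcongr
    _ = (B + C₁) * γ ^ n := by ring
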